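/- Let $m\ge 1$ and $D\ge 0$ be integers. For each coordinate $d=1,\dots,D$ let $-\infty\le t_0^{(d)}<T^{(d)}\le\infty$, let $J_d$ be the set of real points of $[t_0^{(d)},T^{(d)}]$ and $I_d=(t_0^{(d)},T^{(d)})$, and let $c_{0,d},\dots,c_{m-1,d}$ be continuous real functions on $J_d$. Let $y_d$ be a Gaussian process on $J_d$ with $C^{m-1}$ paths whose state vector $(y_d,y_d',\dots,y_d^{(m-1)})$ is a centred Gaussian process, and which solves the forward equation $$\mathcal L_d[y_d]:=y_d^{(m)}+c_{m-1,d}\,y_d^{(m-1)}+\cdots+c_{0,d}\,y_d=W_d ,$$ where $W_d=dB_d$ is a white noise of spectrum $1$: for $s\le t$ in $J_d$ the increment $B_d(t)-B_d(s)$ is $N(0,t-s)$-distributed and independent of the state up to time $s$, and the equation is understood in its integrated form. Let $K_d(s,t)=\operatorname{Cov}(y_d(s),y_d(t))$, and let $\Pi_d(t)$ be the covariance matrix of the state vector at time $t$. The backward operator is $$\mathcal L_{b,d}[u]=\mathcal L_d[u]-\sum_{i=1}^m\bigl(\Pi_d^{-1}\bigr)_{m,i}\,u^{(i-1)}\quad\text{on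 } I_d .$$ Let $\phi_{1,d},\dots,\phi_{m,d}$ be linearly independent solutions of $\mathcal L_d[\phi]=0$ on $I_d$, and $\psi_{1,d},\dots,\psi_{m,d}$ linearly independent solutions of $\mathcal L_{b,d}[\psi]=0$ on $I_d$. Put $K(\mathbf t,\mathbf t')=\sum_{d=1}^D K_d(t_d,t_d')$, and let $H(\mathbf t)\in\mathbb R^{2mD}$ be the vector with the entries $\phi_{j,d}(t_d)$, $\psi_{j,d}(t_d)$ for $1\le j\le m$, $1\le d\le D$. Let $s=2mD+1$ and let $\mathbf t_i=(t_{i,1},\dots,t_{i,D})\in\prod_d I_d$, $i=1,\dots,s$, be any points. Put $$U_d=(-\infty,\min_i t_{i,d})\cup(\max_i t_{i,d},\infty),\qquad U=U_1\times\cdots\times U_D .$$ 1. The system $\sum_{i=1}^{s}a_iH(\mathbf t_i)=0$ has a solution $(a_1,\dots,a_s)\ne 0$. 2. For every solution, $\sum_{i=1}^{s}a_iK(\mathbf t,\mathbf t_i)=0$ for all $\mathbf t\in U\cap\prod_d J_d$. Moreover, for any $(a_1,\dots,a_s)\in\mathbb R^s$, $\sum_{i=1}^{s}a_iH(\mathbf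 t_i)=0$ holds if and only if for every $d$, $\sum_{i=1}^{s}a_iK_d(t,t_{i,d})=0$ for all $t\in U_d\cap J_d$. 3. Call the system minimal if the $2mD$ components of $H$ are linearly independent functions on $\prod_d I_d$, and $2mD+1$ is the least $n$ such that for any $n$ points of $\prod_d I_d$ the system $\sum_{i=1}^n a_iH(\mathbf t_i)=0$ has a nonzero solution. The system is minimal if and only if the solution spaces $\operatorname{span}\{\phi_{j,d},\psi_{j,d}:1\le j\le m\}$ of different coordinates form a direct sum, that is, if and only if there is at most one $d$ for which this span contains the nonzero constant functions. In particular it is always minimal for $D=1$. -/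

import Mathlib

open MeasureTheory ProbabilityTheory

noncomputable section

namespace KernelPacket

/-- The real points of `[t₀, T]`, where `t₀` and `T` may be infinite. -/
def timeInterval (t₀ T : EReal) : Set ℝ := {t | t₀ ≤ (t : EReal) ∧ (t : EReal) ≤ T}

/-- The real points of `(t₀, T)`. -/
def openTimeInterval (t₀ T : EReal) : Set ℝ := {t | t₀ < (t : EReal) ∧ (t : EReal) < T}

/-! ### The Gaussian process and its kernel -/

section Forward

variable {Ω : Type*} [MeasurableSpace Ω]

/-- The state of the process `y` on the time domain `J`: `state J y i t` is `y⁽ⁱ⁾(t)`, the path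
derivative of order `i` (one-sided at an end point that belongs to `J`). -/
def state (J : Set ℝ) (y : ℝ → Ω → ℝ) (i : ℕ) (t : ℝ) (ω : Ω) : ℝ :=
  iteratedDerivWithin i (fun s => y s ω) J t

/-- `y` is a centred Gaussian process on `J` that solves the forward equation
`y⁽ᵐ⁾ + c_{m-1} y⁽ᵐ⁻¹⁾ + ⋯ + c_0 y = W` with `W = dB` a white noise of spectrum `1`.
The equation is understood in its integrated form; the noise after time `s` is independent of the
state up to time `s`. The order is meant to be `m ≥ 1`. -/
structure IsForwardSolution {m : ℕ} (c : Fin m → ℝ → ℝ) (J : Set ℝ) (P : Measure Ω)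
    (y B : ℝ → Ω → ℝ) : Prop where
  /-- The state vector `(y, y', …, y⁽ᵐ⁻¹⁾)` is a Gaussian process on `J`. -/
  gaussian : IsGaussianProcess (fun (p : J × Fin m) ω => state J y p.2 p.1 ω) P
  centred : ∀ t ∈ J, ∀ i : Fin m, ∫ ω, state J y i t ω ∂P = 0
  smooth_paths : ∀ᵐ ω ∂P, ContDiffOn ℝ (m - 1 : ℕ) (fun t => y t ω) J
  noise_law : ∀ s ∈ J, ∀ t ∈ J, s ≤ t →
    HasLaw (fun ω => B t ω - B s ω) (gaussianReal 0 (t - s).toNNReal) P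
  noise_indep : ∀ s ∈ J, ∀ t ∈ J, s ≤ t →
    IndepFun (fun ω (p : {u : ℝ // u ∈ J ∧ u ≤ s} × Fin m) => state J y p.2 p.1 ω)
      (fun ω => B t ω - B s ω) P
  equation : ∀ᵐ ω ∂P, ∀ s ∈ J, ∀ t ∈ J, s ≤ t →
    state J y (m - 1) t ω - state J y (m - 1) s ω
      + ∫ u in s..t, ∑ i : Fin m, c i u * state J y i u ω = B t ω - B s ω

/-- The kernel (covariance function) `K(s, t)` of the process `y`. -/
def kernel (P : Measure Ω) (y : ℝ → Ω → ℝ) (s t : ℝ) : ℝ := cov[y s, y t; P]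

/-- The covariance matrix `Π(t)` of the state vector `(y(t), y'(t), …, y⁽ᵐ⁻¹⁾(t))`. -/
def stateCov (m : ℕ) (J : Set ℝ) (P : Measure Ω) (y : ℝ → Ω → ℝ) (t : ℝ) :
    Matrix (Fin m) (Fin m) ℝ :=
  Matrix.of fun i j => cov[state J y i t, state J y j t; P]

/-- The coefficients of the backward operator
`L_b u = L u - ∑ᵢ Cᵢ u⁽ⁱ⁾`, where `C` is the last row of `Π⁻¹`: indeed the drift matrix of the
backward Markov model is `F + b bᵀ Π⁻¹`, with `F` the companion matrix of `L` and `b` the last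
unit vector. -/
def backwardCoeff {m : ℕ} (c : Fin m → ℝ → ℝ) (J : Set ℝ) (P : Measure Ω) (y : ℝ → Ω → ℝ)
    (i : Fin m) (t : ℝ) : ℝ :=
  c i t - (stateCov m J P y t)⁻¹ ⟨m - 1, Nat.sub_lt i.pos one_pos⟩ i

end Forward

/-! ### Fundamental solutions -/

/-- `u_1, …, u_m` are linearly independent solutions on the open set `I` of
`u⁽ᵐ⁾ + c_{m-1} u⁽ᵐ⁻¹⁾ + ⋯ + c_0 u = 0`. -/
structure IsFundamentalSystem {m : ℕ} (c : Fin m → ℝ → ℝ) (I : Set ℝ) (u : Fin m → ℝ → ℝ) :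
    Prop where
  smooth : ∀ j, ContDiffOn ℝ m (u j) I
  solves : ∀ j, ∀ t ∈ I,
    iteratedDeriv m (u j) t + ∑ i : Fin m, c i t * iteratedDeriv i (u j) t = 0
  linearIndependent : LinearIndependent ℝ fun j (t : I) => u j t

/-- The constant functions on `I` are linear combinations of the `φ_j` and `ψ_j`. -/
def ContainsConstants {m : ℕ} (I : Set ℝ) (φ ψ : Fin m → ℝ → ℝ) : Prop :=
  (fun _ : I => (1 : ℝ)) ∈ Submodule.span ℝ
    (Set.range fun (k : Fin m ⊕ Fin m) (t : I) => Sum.elim φ ψ k t)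

/-! ### Additive kernels and their kernel packets -/

/-- The additive kernel `K(x, x') = ∑_d K_d(x_d, x'_d)`. -/
def additiveKernel {D : ℕ} (K : Fin D → ℝ → ℝ → ℝ) (x x' : Fin D → ℝ) : ℝ :=
  ∑ d, K d (x d) (x' d)

/-- The vector function `H` with the `2mD` components `φ_{j,d}(x_d)`, `ψ_{j,d}(x_d)`. -/
def stackedSolutions {D m : ℕ} (φ ψ : Fin D → Fin m → ℝ → ℝ) (x : Fin D → ℝ) :
    Fin D × (Fin m ⊕ Fin m) → ℝ :=
  fun k => Sum.elim (φ k.1) (ψ k.1) k.2 (x k.1)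

/-- The numbers strictly outside the range of the finite family `τ`: for a nonempty family this is
`(-∞, minᵢ τᵢ) ∪ (maxᵢ τᵢ, ∞)`. -/
def outside {n : ℕ} (τ : Fin n → ℝ) : Set ℝ := {r | (∀ i, r < τ i) ∨ (∀ i, τ i < r)}

/-- The product set `U` of the points `x_1, …, x_n`. -/
def outsideBox {D n : ℕ} (x : Fin n → Fin D → ℝ) : Set (Fin D → ℝ) :=
  {r | ∀ d, r d ∈ outside fun i => x i d}

/-- The system `∑ᵢ aᵢ H(xᵢ) = 0` attached to a vector function `H` on `X` with `N` components is
minimal: no component of `H` is a linear combination of the others, and `N + 1` is the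
least number of points for which there always is a nonzero solution. -/
def IsMinimalSystem {X ι : Type*} [Fintype ι] (H : X → ι → ℝ) : Prop :=
  LinearIndependent ℝ (fun (k : ι) (x : X) => H x k) ∧
  IsLeast {n : ℕ | ∀ x : Fin n → X, ∃ a : Fin n → ℝ, a ≠ 0 ∧ ∑ i, a i • H (x i) = 0}
    (Fintype.card ι + 1)

end KernelPacket

end

/-! Fix one coordinate and let W be the Wronskian matrix of the forward solutions, Q its inverse and
Π the covariance matrix of the state. Q applied to the state changes only through the noise, so for
s ≤ t the states at s and t have the covariance W(t)·Q(s)Π(s) (`ForwardData.cov_state_state`). The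
transpose of QΠ solves the companion system of the backward operator
(`ForwardData.hasEntryDerivAt_gainMatrix_backward`), hence is the Wronskian matrix of the ψ's times
a constant invertible matrix C. This gives K(s,t) = ψ(s)ᵀ C φ(t) for s ≤ t
(`ForwardData.exists_kernel_eq`).

To the left of all nodes, ∑ aᵢ K(·,tᵢ) is thus ψᵀC paired with the sums ∑ aᵢ φ(tᵢ); to the right it
is the sums ∑ aᵢ ψ(tᵢ) paired with Cφ. The ψ's and the φ's stay independent on every open
subinterval and C is invertible, so vanishing on both sides means that all these sums vanish
(`ForwardData.sum_solutions_eq_zero_iff`).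

Nondegeneracy comes from S = QΠQᵀ, whose derivative is qqᵀ with q the last column of Q. As q stays
in no hyperplane on an open set, Π is invertible and the φ's and ψ's together are independent
(`ForwardData.linearIndependent_sumElim`). Minimality is then linear algebra: a sum of functions of
separate coordinates vanishes only if each is constant, so constants lying in two of the spans are
the only obstruction (`linearIndependent_separate_iff`).

The equation holds only pathwise. It passes to covariances because almost sure limits inside a
Gaussian space are L² limits (`memLp_and_tendsto_of_ae_tendsto`). -/

noncomputable section

namespace KernelPacket

open Filter Topology Set
open scoped ENNReal Matrix

set_option linter.unusedSectionVars false

/-! ### Almost sure limits of Gaussian variables and their covariances. -/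

section GaussianLimits

variable {Ω : Type*} [MeasurableSpace Ω] {P : Measure Ω} [IsProbabilityMeasure P]

/-- A space of centred random variables with Gaussian laws. -/
def IsCentredGaussianSpace (P : Measure Ω) (S : Submodule ℝ (Ω → ℝ)) : Prop :=
  ∀ Z ∈ S, HasGaussianLaw Z P ∧ ∫ ω, Z ω ∂P = 0

theorem norm_integral_cexp_of_hasGaussianLaw {Z : Ω → ℝ} (hZ : HasGaussianLaw Z P) :
    ‖∫ ω, Complex.exp (Z ω * Complex.I) ∂P‖ = Real.exp (-(Var[Z; P] / 2)) := by
  have h := hZ.charFun_map_eq (1 : ℝ)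
  rw [charFun_apply_real, integral_map hZ.aemeasurable (by fun_prop)] at h
  have h2 : Var[fun ω => inner ℝ (1 : ℝ) (Z ω); P] = Var[Z; P] := by simp
  rw [h2] at h
  simp only [Complex.ofReal_one, one_mul] at h
  rw [h, Complex.norm_exp]
  simp

theorem eLpNorm_two_eq_of_centred {Z : Ω → ℝ} (hZ : MemLp Z 2 P) (h0 : ∫ ω, Z ω ∂P = 0) :
    eLpNorm Z 2 P = ENNReal.ofReal (√Var[Z; P]) := by
  rw [hZ.eLpNorm_eq_integral_rpow_norm (by simp) (by simp),
    variance_of_integral_eq_zero hZ.aemeasurable h0, Real.sqrt_eq_rpow]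
  simp

/-- Characteristic functions at 1 are bounded by 1, so dominated convergence applies; their modulus
exp(-Var/2) does not see the mean, and the logarithm returns the variance. -/
theorem tendsto_variance_of_ae_tendsto_zero {ι : Type*} {l : Filter ι} [l.IsCountablyGenerated]
    {W : ι → Ω → ℝ} (hW : ∀ i, HasGaussianLaw (W i) P)
    (h : ∀ᵐ ω ∂P, Tendsto (fun i => W i ω) l (𝓝 0)) :
    Tendsto (fun i => Var[W i; P]) l (𝓝 0) := by
  have h1 : Tendsto (fun i => ∫ ω, Complex.exp (W i ω * Complex.I) ∂P) l
      (𝓝 (∫ _, (1 : ℂ) ∂P)) := by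
    refine tendsto_integral_filter_of_dominated_convergence (fun _ => 1) ?_ ?_ (by simp) ?_
    · refine Eventually.of_forall fun i => ?_
      have := (hW i).aemeasurable
      exact (by fun_prop : AEMeasurable (fun ω => Complex.exp (W i ω * Complex.I))
        P).aestronglyMeasurable
    · exact Eventually.of_forall fun i => ae_of_all _ fun ω => by
        rw [Complex.norm_exp_ofReal_mul_I]
    · filter_upwards [h] with ω hω
      have hc : Continuous fun x : ℝ => Complex.exp (x * Complex.I) := by fun_prop
      simpa [Function.comp_def] using (hc.tendsto 0).comp hω
  have h2 := h1.norm
  simp only [norm_integral_cexp_of_hasGaussianLaw (hW _)] at h2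
  have h3 := ((Real.continuousAt_log (x := ‖∫ _, (1 : ℂ) ∂P‖) (by simp)).tendsto.comp h2)
  have h4 := h3.const_mul (-2)
  simp only [Function.comp_def, Real.log_exp] at h4
  refine (h4.congr fun i => by ring).trans (by simp)

/-- The differences over pairs of indices are Gaussian, being in `S`, and tend to zero almost
surely, so their variances tend to zero: the sequence is Cauchy in L². -/
theorem exists_eLpNorm_sub_lt {S : Submodule ℝ (Ω → ℝ)} (hS : IsCentredGaussianSpace P S)
    {W : ℕ → Ω → ℝ} (hW : ∀ n, W n ∈ S) {W' : Ω → ℝ}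
    (h : ∀ᵐ ω ∂P, Tendsto (fun n => W n ω) atTop (𝓝 (W' ω))) {ε : ℝ≥0∞} (hε : 0 < ε) :
    ∃ N, ∀ n m, N ≤ n → N ≤ m → eLpNorm (W n - W m) 2 P < ε := by
  have hg : ∀ q : ℕ × ℕ, HasGaussianLaw (W q.1 - W q.2) P := fun q =>
    (hS _ (S.sub_mem (hW _) (hW _))).1
  have h1 : Tendsto (fun q : ℕ × ℕ => Var[W q.1 - W q.2; P]) (atTop ×ˢ atTop) (𝓝 0) := by
    refine tendsto_variance_of_ae_tendsto_zero hg ?_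
    filter_upwards [h] with ω hω
    simpa using (hω.comp tendsto_fst).sub (hω.comp tendsto_snd)
  have h2 : Tendsto (fun q : ℕ × ℕ => eLpNorm (W q.1 - W q.2) 2 P) (atTop ×ˢ atTop) (𝓝 0) := by
    have : Tendsto (fun x : ℝ => ENNReal.ofReal √x) (𝓝 0) (𝓝 0) := by
      have hc : Continuous fun x : ℝ => ENNReal.ofReal √x :=
        ENNReal.continuous_ofReal.comp Real.continuous_sqrt
      simpa using hc.tendsto 0
    refine (this.comp h1).congr fun q => ?_
    exact (eLpNorm_two_eq_of_centred (hg q).memLp_two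
      (hS _ (S.sub_mem (hW _) (hW _))).2).symm
  rw [prod_atTop_atTop_eq] at h2
  obtain ⟨N, hN⟩ := eventually_atTop.1 (h2.eventually_lt_const hε)
  exact ⟨max N.1 N.2, fun n m hn hm => hN (n, m)
    ⟨(le_max_left _ _).trans hn, (le_max_right _ _).trans hm⟩⟩

/-- Fatou's lemma for the L² norm turns the Cauchy bound into convergence to the pointwise limit,
which need not be known to lie in `S`. -/
theorem memLp_and_tendsto_of_ae_tendsto {S : Submodule ℝ (Ω → ℝ)}
    (hS : IsCentredGaussianSpace P S) {W : ℕ → Ω → ℝ} (hW : ∀ n, W n ∈ S) {W' : Ω → ℝ}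
    (h : ∀ᵐ ω ∂P, Tendsto (fun n => W n ω) atTop (𝓝 (W' ω))) :
    MemLp W' 2 P ∧ Tendsto (fun n => eLpNorm (W n - W') 2 P) atTop (𝓝 0) := by
  have hLp : ∀ n, MemLp (W n) 2 P := fun n => (hS _ (hW n)).1.memLp_two
  have ht : Tendsto (fun n => eLpNorm (W n - W') 2 P) atTop (𝓝 0) := by
    rw [ENNReal.tendsto_atTop_zero]
    intro ε hε
    obtain ⟨N, hN⟩ := exists_eLpNorm_sub_lt hS hW h hε
    refine ⟨N, fun n hn => ?_⟩
    refine (Lp.eLpNorm_lim_le_liminf_eLpNorm (f := fun m => W n - W m)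
      (fun m => ((hLp n).sub (hLp m)).aestronglyMeasurable) (W n - W') ?_).trans ?_
    · filter_upwards [h] with ω hω using hω.const_sub _
    · refine liminf_le_of_frequently_le' (frequently_atTop.mpr fun N1 =>
        ⟨max N N1, le_max_right _ _, (hN n _ hn (le_max_left _ _)).le⟩)
  have hm : AEStronglyMeasurable W' P :=
    aestronglyMeasurable_of_tendsto_ae atTop (fun n => (hLp n).aestronglyMeasurable) h
  exact ⟨Lp.memLp_of_cauchy_tendsto one_le_two hLp W' hm ht, ht⟩

theorem tendsto_covariance_of_tendsto_eLpNorm {ι : Type*} {l : Filter ι} {W : ι → Ω → ℝ}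
    {W' Z : Ω → ℝ} (hZ : MemLp Z 2 P) (hW : ∀ i, MemLp (W i) 2 P) (hW' : MemLp W' 2 P)
    (h : Tendsto (fun i => eLpNorm (W i - W') 2 P) l (𝓝 0)) :
    Tendsto (fun i => cov[Z, W i; P]) l (𝓝 cov[Z, W'; P]) := by
  have h1 := (Lp.tendsto_Lp_iff_tendsto_eLpNorm'' W hW W' hW').2 h
  have key : ∀ {Y X : Ω → ℝ} (hY : MemLp Y 2 P) (hX : MemLp X 2 P),
      inner ℝ (hY.toLp Y) (hX.toLp X) = ∫ ω, Y ω * X ω ∂P := by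
    intro Y X hY hX
    rw [L2.inner_def]
    refine integral_congr_ae ?_
    filter_upwards [hY.coeFn_toLp, hX.coeFn_toLp] with ω h1 h2
    rw [h1, h2]; simp [mul_comm]
  have h1' : MemLp (fun _ : Ω => (1 : ℝ)) 2 P := memLp_const 1
  have h2 := (tendsto_const_nhds (x := hZ.toLp Z)).inner (𝕜 := ℝ) h1
  have h3 := (tendsto_const_nhds (x := h1'.toLp _)).inner (𝕜 := ℝ) h1
  simp only [key, one_mul] at h2 h3
  rw [covariance_eq_sub hZ hW']
  refine (h2.sub (h3.const_mul (∫ ω, Z ω ∂P))).congr fun i => ?_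
  rw [covariance_eq_sub hZ (hW i)]
  rfl

theorem tendsto_covariance_of_ae_tendsto {S : Submodule ℝ (Ω → ℝ)}
    (hS : IsCentredGaussianSpace P S) {ι : Type*} {l : Filter ι} [l.IsCountablyGenerated]
    {W : ι → Ω → ℝ} (hW : ∀ i, W i ∈ S) {W' Z : Ω → ℝ} (hZ : MemLp Z 2 P)
    (h : ∀ᵐ ω ∂P, Tendsto (fun i => W i ω) l (𝓝 (W' ω))) :
    Tendsto (fun i => cov[Z, W i; P]) l (𝓝 cov[Z, W'; P]) := by
  refine tendsto_of_seq_tendsto fun u hu => ?_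
  obtain ⟨h1, h2⟩ := memLp_and_tendsto_of_ae_tendsto hS (fun n => hW (u n))
    (h.mono fun ω hω => hω.comp hu)
  exact tendsto_covariance_of_tendsto_eLpNorm hZ (fun n => (hS _ (hW (u n))).1.memLp_two) h1 h2

theorem tendsto_covariance_of_ae_tendsto_of_eventually {S : Submodule ℝ (Ω → ℝ)}
    (hS : IsCentredGaussianSpace P S) {ι : Type*} {l : Filter ι} [l.IsCountablyGenerated]
    {W : ι → Ω → ℝ} (hW : ∀ᶠ i in l, W i ∈ S) {W' Z : Ω → ℝ} (hZ : MemLp Z 2 P)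
    (h : ∀ᵐ ω ∂P, Tendsto (fun i => W i ω) l (𝓝 (W' ω))) :
    Tendsto (fun i => cov[Z, W i; P]) l (𝓝 cov[Z, W'; P]) := by
  classical
  -- Off the eventual set, replace by 0, which lies in every subspace. This serves filters such as
  -- `𝓝[J] t`, where states are controlled only for times in `J`.
  set V : ι → Ω → ℝ := fun i => if W i ∈ S then W i else 0 with hV
  have hVW : ∀ᶠ i in l, V i = W i := hW.mono fun i hi => by simp [hV, hi]
  refine (tendsto_covariance_of_ae_tendsto hS (W := V) (fun i => ?_) hZ ?_).congr'
    (hVW.mono fun i hi => by rw [hi])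
  · by_cases hi : W i ∈ S <;> simp [hV, hi]
  · exact h.mono fun ω hω => hω.congr' (hVW.mono fun i hi => (congrFun hi ω).symm)

theorem isCentredGaussianSpace_span {T : Type*} {X : T → Ω → ℝ} (hX : IsGaussianProcess X P)
    (h0 : ∀ t, ∫ ω, X t ω ∂P = 0) :
    IsCentredGaussianSpace P (Submodule.span ℝ (Set.range X)) := by
  intro Z hZ
  obtain ⟨a, rfl⟩ := Finsupp.mem_span_range_iff_exists_finsupp.1 hZ
  constructor
  · have h := (hX.hasGaussianLaw a.support).map (∑ i : a.support, a i • .proj i)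
    convert! h
    ext ω
    simp [Finsupp.sum, ← Finset.sum_coe_sort a.support]
  · have hi : ∀ t, Integrable (X t) P := fun t => (hX.hasGaussianLaw_eval t).integrable
    simp only [Finsupp.sum, Finset.sum_apply, Pi.smul_apply, smul_eq_mul]
    rw [integral_finsetSum _ fun i _ => (hi i).const_mul _]
    simp [integral_const_mul, h0]

end GaussianLimits

/-! ### Riemann sums, which approximate path integrals by finite combinations of states. -/

/-- Riemann sums with equidistant nodes. -/
def riemannSum (g : ℝ → ℝ) (a b : ℝ) (N : ℕ) : ℝ :=
  ∑ k ∈ Finset.range N, (b - a) / N * g (a + k * ((b - a) / N))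

theorem tendsto_riemannSum {g : ℝ → ℝ} {a b : ℝ} (hab : a ≤ b) (hg : ContinuousOn g (Icc a b)) :
    Tendsto (riemannSum g a b) atTop (𝓝 (∫ u in a..b, g u)) := by
  rw [Metric.tendsto_atTop]
  intro ε hε
  have huc := isCompact_Icc.uniformContinuousOn_of_continuous hg
  rw [Metric.uniformContinuousOn_iff] at huc
  -- The summand 1 keeps the denominator positive for `a = b` and makes the final bound strict.
  obtain ⟨δ, hδ, hd⟩ := huc (ε / (b - a + 1)) (by have := sub_nonneg.2 hab; positivity)
  obtain ⟨N, hN⟩ := exists_nat_gt ((b - a) / δ)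
  refine ⟨N + 1, fun n hn => ?_⟩
  have hn0 : (0 : ℝ) < n := by exact_mod_cast (Nat.succ_pos N).trans_le hn
  have hNn : (N : ℝ) ≤ n := by exact_mod_cast (Nat.le_succ N).trans hn
  set h := (b - a) / n with hh
  have hba := sub_nonneg.2 hab
  have h0 : 0 ≤ h := by positivity
  have hnh : n * h = b - a := by rw [hh]; field_simp
  have hhδ : h < δ := by
    rw [hh, div_lt_iff₀ hn0]
    rw [div_lt_iff₀ hδ] at hN
    nlinarith
  set τ : ℕ → ℝ := fun k => a + k * h with hτ
  have hτs : ∀ k, τ (k + 1) = τ k + h := fun k => by simp only [hτ]; push_cast; ring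
  have hτm : ∀ k ≤ n, τ k ∈ Icc a b := fun k hk => by
    have h1 : (k : ℝ) ≤ n := by exact_mod_cast hk
    have h2 : (0 : ℝ) ≤ k := k.cast_nonneg
    constructor <;> simp only [hτ] <;> nlinarith
  have hsub : ∀ k < n, Icc (τ k) (τ (k + 1)) ⊆ Icc a b := fun k hk =>
    Icc_subset_Icc (hτm k hk.le).1 (hτm (k + 1) hk).2
  have hint : ∀ k < n, IntervalIntegrable g volume (τ k) (τ (k + 1)) := fun k hk =>
    (hg.mono (by rw [uIcc_of_le (by rw [hτs]; linarith)]; exact hsub k hk)).intervalIntegrable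
  have hsum := intervalIntegral.sum_integral_adjacent_intervals hint
  have e0 : τ 0 = a := by simp [hτ]
  have en : τ n = b := by simp only [hτ]; linarith
  rw [e0, en] at hsum
  rw [← hsum, dist_comm, Real.dist_eq, riemannSum, ← Finset.sum_sub_distrib]
  refine (Finset.abs_sum_le_sum_abs _ _).trans_lt ?_
  have hk : ∀ k ∈ Finset.range n,
      |(∫ u in τ k..τ (k + 1), g u) - h * g (τ k)| ≤ ε / (b - a + 1) * h := by
    intro k hk
    rw [Finset.mem_range] at hk
    have e1 : h * g (τ k) = ∫ u in τ k..τ (k + 1), g (τ k) := by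
      rw [intervalIntegral.integral_const, hτs]; simp
    rw [e1, ← intervalIntegral.integral_sub (hint k hk) (by simp), ← Real.norm_eq_abs]
    refine (intervalIntegral.norm_integral_le_of_norm_le_const (C := ε / (b - a + 1)) ?_).trans ?_
    · intro u hu
      rw [uIoc_of_le (by rw [hτs]; linarith)] at hu
      have h1 := hsub k hk ⟨hu.1.le, hu.2⟩
      refine (hd u h1 (τ k) (hτm k hk.le) ?_).le
      rw [Real.dist_eq, abs_lt]
      have := hu.1; have := hu.2; rw [hτs] at this
      constructor <;> linarith
    · rw [hτs]; simp [abs_of_nonneg h0]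
  refine (Finset.sum_le_sum hk).trans_lt ?_
  rw [Finset.sum_const, Finset.card_range, nsmul_eq_mul]
  calc (n : ℝ) * (ε / (b - a + 1) * h) = ε * ((b - a) / (b - a + 1)) := by rw [← hnh]; ring
    _ < ε * 1 := by
      refine mul_lt_mul_of_pos_left ?_ hε
      rw [div_lt_one (by linarith)]; linarith
    _ = ε := mul_one _

/-! ### Covariances of a square integrable variable with states and noise. -/

section States

variable {Ω : Type*} [MeasurableSpace Ω] {P : Measure Ω} [IsProbabilityMeasure P]
  {n : ℕ} {c : Fin (n + 1) → ℝ → ℝ} {J : Set ℝ} {y B : ℝ → Ω → ℝ}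

/-- The linear span of the states of the process. -/
def stateSpace (n : ℕ) (J : Set ℝ) (y : ℝ → Ω → ℝ) : Submodule ℝ (Ω → ℝ) :=
  Submodule.span ℝ (Set.range fun (p : J × Fin (n + 1)) => state J y p.2 p.1)

/-- The increment of the noise from `s` to `t`. -/
def increment (B : ℝ → Ω → ℝ) (s t : ℝ) : Ω → ℝ := fun ω => B t ω - B s ω

theorem state_mem_stateSpace {t : ℝ} (ht : t ∈ J) (i : Fin (n + 1)) :
    state J y i t ∈ stateSpace n J y :=
  Submodule.subset_span ⟨(⟨t, ht⟩, i), rfl⟩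

theorem IsForwardSolution.isCentredGaussianSpace (hy : IsForwardSolution c J P y B) :
    IsCentredGaussianSpace P (stateSpace n J y) :=
  isCentredGaussianSpace_span hy.gaussian fun p => hy.centred _ p.1.2 p.2

theorem IsForwardSolution.memLp_of_mem (hy : IsForwardSolution c J P y B) {Z : Ω → ℝ}
    (hZ : Z ∈ stateSpace n J y) : MemLp Z 2 P :=
  (hy.isCentredGaussianSpace Z hZ).1.memLp_two

theorem IsForwardSolution.memLp_state (hy : IsForwardSolution c J P y B) {t : ℝ} (ht : t ∈ J)
    (i : Fin (n + 1)) : MemLp (state J y i t) 2 P :=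
  hy.memLp_of_mem (state_mem_stateSpace ht i)

theorem IsForwardSolution.ae_continuousOn_state (hJ : UniqueDiffOn ℝ J)
    (hy : IsForwardSolution c J P y B) :
    ∀ᵐ ω ∂P, ∀ i : Fin (n + 1), ContinuousOn (fun t => state J y i t ω) J := by
  filter_upwards [hy.smooth_paths] with ω hω i
  exact hω.continuousOn_iteratedDerivWithin (by simpa using Fin.is_le i) hJ

theorem IsForwardSolution.ae_hasDerivWithinAt_state (hJ : UniqueDiffOn ℝ J)
    (hy : IsForwardSolution c J P y B) :
    ∀ᵐ ω ∂P, ∀ (i : Fin n), ∀ t ∈ J,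
      HasDerivWithinAt (fun t => state J y i.castSucc t ω) (state J y i.succ t ω) J t := by
  filter_upwards [hy.smooth_paths] with ω hω i t ht
  have h := hω.differentiableOn_iteratedDerivWithin (m := i) (by simp) hJ t ht
  have h2 := h.hasDerivWithinAt
  rw [← iteratedDerivWithin_succ] at h2
  exact h2

theorem IsForwardSolution.continuousOn_cov_state (hJ : UniqueDiffOn ℝ J)
    (hy : IsForwardSolution c J P y B) {Z : Ω → ℝ} (hZ : MemLp Z 2 P) (i : Fin (n + 1)) :
    ContinuousOn (fun t => cov[Z, state J y i t; P]) J := by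
  intro t ht
  refine tendsto_covariance_of_ae_tendsto_of_eventually hy.isCentredGaussianSpace ?_ hZ ?_
  · filter_upwards [self_mem_nhdsWithin] with s hs using state_mem_stateSpace hs i
  · filter_upwards [hy.ae_continuousOn_state hJ] with ω hω using hω i t ht

/-- Difference quotients of a state are again in the Gaussian space and converge pathwise to the
next state, so the derivative may be taken inside the covariance. -/
theorem IsForwardSolution.hasDerivWithinAt_cov_state (hJ : UniqueDiffOn ℝ J)
    (hy : IsForwardSolution c J P y B) {Z : Ω → ℝ} (hZ : MemLp Z 2 P) (i : Fin n) {t : ℝ}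
    (ht : t ∈ J) :
    HasDerivWithinAt (fun t => cov[Z, state J y i.castSucc t; P]) cov[Z, state J y i.succ t; P]
      J t := by
  rw [hasDerivWithinAt_iff_tendsto_slope]
  have h := tendsto_covariance_of_ae_tendsto_of_eventually (P := P) hy.isCentredGaussianSpace
    (W := fun s => (s - t)⁻¹ • (state J y i.castSucc s - state J y i.castSucc t))
    (W' := state J y i.succ t) (l := 𝓝[J \ {t}] t) ?_ hZ ?_
  · refine h.congr' ?_
    filter_upwards [self_mem_nhdsWithin] with s hs
    rw [covariance_smul_right, covariance_sub_right hZ (hy.memLp_state hs.1 i.castSucc)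
      (hy.memLp_state ht i.castSucc), slope_def_field]
    simp only [Fin.val_castSucc]
    ring
  · filter_upwards [self_mem_nhdsWithin] with s hs
    exact Submodule.smul_mem _ _ (Submodule.sub_mem _ (state_mem_stateSpace hs.1 i.castSucc)
      (state_mem_stateSpace ht i.castSucc))
  · filter_upwards [hy.ae_hasDerivWithinAt_state hJ] with ω hω
    exact (hasDerivWithinAt_iff_tendsto_slope.1 (hω i t ht)).congr fun s => by
      simp [slope_def_field]; ring

theorem riemannSum_node_mem {s t : ℝ} (hst : s ≤ t) {N k : ℕ} (hk : k < N) :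
    s + k * ((t - s) / N) ∈ Icc s t := by
  have hN : (0 : ℝ) < N := by exact_mod_cast (Nat.zero_le k).trans_lt hk
  have h1 : (k : ℝ) / N ≤ 1 := by
    rw [div_le_one hN]; exact_mod_cast hk.le
  have h2 : 0 ≤ (k : ℝ) / N := by positivity
  have e : k * ((t - s) / N) = (k : ℝ) / N * (t - s) := by ring
  rw [e]
  have := sub_nonneg.2 hst
  constructor <;> nlinarith

theorem IsForwardSolution.cov_riemannSum (hJo : J.OrdConnected)
    (hy : IsForwardSolution c J P y B) {Z : Ω → ℝ} (hZ : MemLp Z 2 P) {s t : ℝ} (hs : s ∈ J)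
    (ht : t ∈ J) (hst : s ≤ t) (N : ℕ) :
    (fun ω => riemannSum (fun u => ∑ i, c i u * state J y i u ω) s t N) ∈ stateSpace n J y ∧
    cov[Z, fun ω => riemannSum (fun u => ∑ i, c i u * state J y i u ω) s t N; P] =
      riemannSum (fun u => ∑ i, c i u * cov[Z, state J y i u; P]) s t N := by
  have hmem : ∀ k ∈ Finset.range N, s + k * ((t - s) / N) ∈ J := fun k hk =>
    hJo.out hs ht (riemannSum_node_mem hst (Finset.mem_range.1 hk))
  have e : (fun ω => riemannSum (fun u => ∑ i, c i u * state J y i u ω) s t N) =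
      ∑ k ∈ Finset.range N, ((t - s) / N) • ∑ i, c i (s + k * ((t - s) / N)) •
        state J y i (s + k * ((t - s) / N)) := by
    ext ω
    simp [riemannSum]
  rw [e]
  have hin : ∀ k ∈ Finset.range N, ∀ i : Fin (n + 1), c i (s + k * ((t - s) / N)) •
        state J y i (s + k * ((t - s) / N)) ∈ stateSpace n J y := fun k hk i =>
    Submodule.smul_mem _ _ (state_mem_stateSpace (hmem k hk) i)
  constructor
  · exact Submodule.sum_mem _ fun k hk => Submodule.smul_mem _ _ <|
      Submodule.sum_mem _ fun i _ => hin k hk i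
  · rw [covariance_sum_right' (fun k hk => hy.memLp_of_mem (Submodule.smul_mem _ _ <|
      Submodule.sum_mem _ fun i _ => hin k hk i)) hZ]
    refine Finset.sum_congr rfl fun k hk => ?_
    rw [covariance_smul_right, covariance_sum_right (fun i => hy.memLp_of_mem (hin k hk i)) hZ]
    simp_rw [covariance_smul_right]

/-- The integrated equation, paired with `Z`. Covariance and path integral are exchanged through
Riemann sums, so Fubini and joint measurability are not needed. -/
theorem IsForwardSolution.cov_increment (hJo : J.OrdConnected) (hJ : UniqueDiffOn ℝ J)
    (hc : ∀ i, ContinuousOn (c i) J)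
    (hy : IsForwardSolution c J P y B) {Z : Ω → ℝ} (hZ : MemLp Z 2 P) {s t : ℝ} (hs : s ∈ J)
    (ht : t ∈ J) (hst : s ≤ t) :
    cov[Z, increment B s t; P] = cov[Z, state J y n t; P] - cov[Z, state J y n s; P]
      + ∫ u in s..t, ∑ i, c i u * cov[Z, state J y i u; P] := by
  have hsub : Icc s t ⊆ J := hJo.out hs ht
  have hn : ∀ {r}, r ∈ J → state J y n r ∈ stateSpace n J y := fun hr =>
    state_mem_stateSpace hr (Fin.last n)
  have h1 : Tendsto (fun N => cov[Z, state J y n t - state J y n s +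
      fun ω => riemannSum (fun u => ∑ i, c i u * state J y i u ω) s t N; P]) atTop
      (𝓝 cov[Z, increment B s t; P]) := by
    refine tendsto_covariance_of_ae_tendsto hy.isCentredGaussianSpace (fun N => ?_) hZ ?_
    · exact Submodule.add_mem _ (Submodule.sub_mem _ (hn ht) (hn hs))
        (hy.cov_riemannSum hJo hZ hs ht hst N).1
    · filter_upwards [hy.equation, hy.ae_continuousOn_state hJ] with ω h2 h3
      have h4 := h2 s hs t ht hst
      simp only [Nat.add_sub_cancel] at h4
      rw [increment, ← h4]
      refine tendsto_const_nhds.add (tendsto_riemannSum hst ?_)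
      exact continuousOn_finsetSum _ fun i _ => ((hc i).mul (h3 i)).mono hsub
  refine tendsto_nhds_unique h1 ?_
  have h5 : Tendsto (riemannSum (fun u => ∑ i, c i u * cov[Z, state J y i u; P]) s t) atTop
      (𝓝 (∫ u in s..t, ∑ i, c i u * cov[Z, state J y i u; P])) :=
    tendsto_riemannSum hst <| continuousOn_finsetSum _ fun i _ =>
      ((hc i).mul (hy.continuousOn_cov_state hJ hZ i)).mono hsub
  refine (h5.const_add _).congr fun N => ?_
  rw [covariance_add_right hZ (hy.memLp_of_mem (Submodule.sub_mem _ (hn ht) (hn hs)))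
      (hy.memLp_of_mem (hy.cov_riemannSum hJo hZ hs ht hst N).1),
    covariance_sub_right hZ (hy.memLp_of_mem (hn ht)) (hy.memLp_of_mem (hn hs)),
    (hy.cov_riemannSum hJo hZ hs ht hst N).2]

theorem IsForwardSolution.memLp_increment (hy : IsForwardSolution c J P y B) {s t : ℝ}
    (hs : s ∈ J) (ht : t ∈ J) (hst : s ≤ t) : MemLp (increment B s t) 2 P :=
  (hy.noise_law s hs t ht hst).hasGaussianLaw.memLp_two

theorem IsForwardSolution.cov_increment_self (hy : IsForwardSolution c J P y B) {s t : ℝ}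
    (hs : s ∈ J) (ht : t ∈ J) (hst : s ≤ t) :
    cov[increment B s t, increment B s t; P] = t - s := by
  have h : HasLaw (increment B s t) (gaussianReal 0 (t - s).toNNReal) P :=
    hy.noise_law s hs t ht hst
  rw [covariance_self (hy.memLp_increment hs ht hst).aemeasurable, h.variance_eq,
    variance_id_gaussianReal,
    Real.coe_toNNReal _ (sub_nonneg.2 hst)]

theorem IsForwardSolution.cov_state_increment (hy : IsForwardSolution c J P y B) {r s t : ℝ}
    (hr : r ∈ J) (hs : s ∈ J) (ht : t ∈ J) (hrs : r ≤ s) (hst : s ≤ t) (i : Fin (n + 1)) :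
    cov[state J y i r, increment B s t; P] = 0 := by
  have h := (hy.noise_indep s hs t ht hst).comp
    (measurable_pi_apply ((⟨r, hr, hrs⟩, i) : {u : ℝ // u ∈ J ∧ u ≤ s} × Fin (n + 1)))
    measurable_id
  exact h.covariance_eq_zero (hy.memLp_state hr i) (hy.memLp_increment hs ht hst)

theorem IsForwardSolution.cov_increment_state (hy : IsForwardSolution c J P y B) {r s t : ℝ}
    (hr : r ∈ J) (hs : s ∈ J) (ht : t ∈ J) (hrs : r ≤ s) (hst : s ≤ t) (i : Fin (n + 1)) :
    cov[increment B s t, state J y i r; P] = 0 := by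
  rw [covariance_comm, hy.cov_state_increment hr hs ht hrs hst]

/-- The definition makes noise independent of past states only. The past increment is an expression
in past states by the equation, so it too is uncorrelated with later noise. -/
theorem IsForwardSolution.cov_increment_increment_of_le (hJo : J.OrdConnected)
    (hJ : UniqueDiffOn ℝ J) (hc : ∀ i, ContinuousOn (c i) J)
    (hy : IsForwardSolution c J P y B) {q r s t : ℝ} (hq : q ∈ J) (hr : r ∈ J) (hs : s ∈ J)
    (ht : t ∈ J) (hqr : q ≤ r) (hrs : r ≤ s) (hst : s ≤ t) :
    cov[increment B s t, increment B q r; P] = 0 := by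
  have hz : ∀ u ∈ Icc q r, ∀ i : Fin (n + 1), cov[increment B s t, state J y i u; P] = 0 :=
    fun u hu i => hy.cov_increment_state (hJo.out hq hr hu) hs ht (hu.2.trans hrs) hst i
  rw [hy.cov_increment hJo hJ hc (hy.memLp_increment hs ht hst) hq hr hqr]
  have h1 := hz r (right_mem_Icc.2 hqr) (Fin.last n)
  have h2 := hz q (left_mem_Icc.2 hqr) (Fin.last n)
  rw [Fin.val_last] at h1 h2
  rw [h1, h2, intervalIntegral.integral_congr (g := fun _ => 0)]
  · simp
  · intro u hu
    rw [uIcc_of_le hqr] at hu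
    simp [hz u hu]

theorem IsForwardSolution.cov_increment_increment (hJo : J.OrdConnected)
    (hJ : UniqueDiffOn ℝ J) (hc : ∀ i, ContinuousOn (c i) J)
    (hy : IsForwardSolution c J P y B) {r s t u : ℝ} (hr : r ∈ J) (hs : s ∈ J) (ht : t ∈ J)
    (hu : u ∈ J) (hrs : r ≤ s) (hst : s ≤ t) (htu : t ≤ u) :
    cov[increment B r u, increment B s t; P] = t - s := by
  have e : increment B r u = increment B r s + (increment B s t + increment B t u) := by
    ext ω; simp [increment]
  have m1 := hy.memLp_increment hr hs hrs
  have m2 := hy.memLp_increment hs ht hst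
  have m3 := hy.memLp_increment ht hu htu
  rw [e, covariance_add_left m1 (m2.add m3) m2, covariance_add_left m2 m3 m2,
    hy.cov_increment_self hs ht hst,
    hy.cov_increment_increment_of_le hJo hJ hc hs ht ht hu hst le_rfl htu, covariance_comm,
    hy.cov_increment_increment_of_le hJo hJ hc hr hs hs ht hrs le_rfl hst]
  ring

end States

/-! ### Entrywise differential calculus for matrices. -/

section EntrywiseDerivative

variable {ι κ μ : Type*} [Fintype ι] [DecidableEq ι] [Fintype κ]

/-- The matrix function `M` has the entrywise derivative `M'` at `t`. -/
def HasEntryDerivAt (M : ℝ → Matrix ι κ ℝ) (M' : Matrix ι κ ℝ) (t : ℝ) : Prop :=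
  ∀ i j, HasDerivAt (fun s => M s i j) (M' i j) t

theorem HasEntryDerivAt.mul {M : ℝ → Matrix ι κ ℝ} {N : ℝ → Matrix κ μ ℝ} {M' N'} {t : ℝ}
    [Fintype μ] (hM : HasEntryDerivAt M M' t) (hN : HasEntryDerivAt N N' t) :
    HasEntryDerivAt (fun s => M s * N s) (M' * N t + M t * N') t := by
  intro i j
  simp only [Matrix.mul_apply, Matrix.add_apply, ← Finset.sum_add_distrib]
  exact HasDerivAt.fun_sum fun k _ => (hM i k).fun_mul (hN k j)

theorem HasEntryDerivAt.mulVec {M : ℝ → Matrix ι κ ℝ} {v : ℝ → κ → ℝ} {M' v'} {t : ℝ}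
    (hM : HasEntryDerivAt M M' t) (hv : ∀ k, HasDerivAt (fun s => v s k) (v' k) t) (i : ι) :
    HasDerivAt (fun s => (M s *ᵥ v s) i) ((M' *ᵥ v t + M t *ᵥ v') i) t := by
  simp only [Matrix.mulVec, dotProduct, Pi.add_apply, ← Finset.sum_add_distrib]
  exact HasDerivAt.fun_sum fun k _ => (hM i k).fun_mul (hv k)

theorem HasEntryDerivAt.transpose {M : ℝ → Matrix ι κ ℝ} {M'} {t : ℝ}
    (hM : HasEntryDerivAt M M' t) : HasEntryDerivAt (fun s => (M s)ᵀ) M'ᵀ t :=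
  fun i j => hM j i

theorem HasEntryDerivAt.congr_deriv {M : ℝ → Matrix ι κ ℝ} {M' N'} {t : ℝ}
    (hM : HasEntryDerivAt M M' t) (h : M' = N') : HasEntryDerivAt M N' t := h ▸ hM

theorem differentiableAt_det {M : ℝ → Matrix ι ι ℝ} {t : ℝ}
    (hM : ∀ i j, DifferentiableAt ℝ (fun s => M s i j) t) :
    DifferentiableAt ℝ (fun s => (M s).det) t := by
  simp only [Matrix.det_apply]
  exact DifferentiableAt.fun_sum fun σ _ =>
    (DifferentiableAt.fun_finsetProd fun i _ => hM _ _).const_smul _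

/-- Cramer's rule gives differentiability; the value of the derivative then follows by
differentiating `M⁻¹ * M = 1`, valid near `t`. -/
theorem HasEntryDerivAt.inv {M : ℝ → Matrix ι ι ℝ} {M'} {t : ℝ}
    (hM : HasEntryDerivAt M M' t) (h : (M t).det ≠ 0) :
    HasEntryDerivAt (fun s => (M s)⁻¹) (-((M t)⁻¹ * M' * (M t)⁻¹)) t := by
  have hd : ∀ i j, DifferentiableAt ℝ (fun s => M s i j) t := fun i j => (hM i j).differentiableAt
  have hdet := differentiableAt_det hd
  have hinv : ∀ i j, DifferentiableAt ℝ (fun s => (M s)⁻¹ i j) t := by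
    intro i j
    have h2 : DifferentiableAt ℝ (fun s => ((M s).updateRow j (Pi.single i 1)).det) t := by
      refine differentiableAt_det fun k l => ?_
      by_cases hk : k = j
      · subst hk; simp
      · simpa [Matrix.updateRow_ne hk] using hd k l
    simp only [Matrix.inv_def, Ring.inverse_eq_inv', Matrix.smul_apply, Matrix.adjugate_apply,
      smul_eq_mul]
    exact (hdet.fun_inv h).fun_mul h2
  set N' : Matrix ι ι ℝ := Matrix.of fun i j => deriv (fun s => (M s)⁻¹ i j) t
  have hN : HasEntryDerivAt (fun s => (M s)⁻¹) N' t := fun i j => (hinv i j).hasDerivAt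
  have hev : ∀ᶠ s in 𝓝 t, (M s)⁻¹ * M s = 1 := by
    filter_upwards [hdet.continuousAt.eventually_ne h] with s hs
    exact Matrix.nonsing_inv_mul _ (isUnit_iff_ne_zero.2 hs)
  have h0 : N' * M t + (M t)⁻¹ * M' = 0 := by
    ext i j
    refine (hN.mul hM i j).unique ?_
    refine (hasDerivAt_const t ((1 : Matrix ι ι ℝ) i j)).congr_of_eventuallyEq ?_
    filter_upwards [hev] with s hs
    rw [hs]
  refine hN.congr_deriv ?_
  have h1 : N' * M t = -((M t)⁻¹ * M') := eq_neg_of_add_eq_zero_left h0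
  calc N' = N' * M t * (M t)⁻¹ := by
        rw [Matrix.mul_assoc, Matrix.mul_nonsing_inv _ (isUnit_iff_ne_zero.2 h), Matrix.mul_one]
    _ = _ := by rw [h1, Matrix.neg_mul]

/-- A matrix function with vanishing derivative on an open interval is constant. -/
theorem eq_of_hasEntryDerivAt_zero {I : Set ℝ} (hI : I.OrdConnected) {M : ℝ → Matrix ι κ ℝ}
    (hM : ∀ t ∈ I, HasEntryDerivAt M 0 t) {s t : ℝ} (hs : s ∈ I) (ht : t ∈ I) : M s = M t := by
  ext i j
  refine Convex.is_const_of_fderivWithin_eq_zero (𝕜 := ℝ) (f := fun s => M s i j)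
    hI.convex (fun u hu => (hM u hu i j).differentiableAt.differentiableWithinAt)
    (fun u hu => ?_) hs ht
  by_cases hU : UniqueDiffWithinAt ℝ I u
  · have h := (hM u hu i j).hasFDerivAt.hasFDerivWithinAt.fderivWithin hU
    rw [h]; ext; simp
  · exact fderivWithin_zero_of_not_uniqueDiffWithinAt hU

end EntrywiseDerivative

/-! ### Uniqueness for linear systems. -/

section LinearODE

variable {ι : Type*} [Fintype ι] [DecidableEq ι] {I : Set ℝ}

theorem exists_Ioo_mem_of_isOpen (hI : IsOpen I) {s t : ℝ} (hs : s ∈ I) (ht : t ∈ I) :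
    ∃ a ∈ I, ∃ b ∈ I, s ∈ Ioo a b ∧ t ∈ Ioo a b := by
  have hmin : min s t ∈ I := by rcases min_choice s t with h | h <;> rwa [h]
  have hmax : max s t ∈ I := by rcases max_choice s t with h | h <;> rwa [h]
  obtain ⟨l, u, h1, h2⟩ := mem_nhds_iff_exists_Ioo_subset.1 (hI.mem_nhds hmin)
  obtain ⟨l', u', h1', h2'⟩ := mem_nhds_iff_exists_Ioo_subset.1 (hI.mem_nhds hmax)
  obtain ⟨a, ha1, ha2⟩ := exists_between h1.1
  obtain ⟨b, hb1, hb2⟩ := exists_between h1'.2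
  exact ⟨a, h2 ⟨ha1, ha2.trans h1.2⟩, b, h2' ⟨h1'.1.trans hb1, hb2⟩,
    ⟨ha2.trans_le (min_le_left _ _), (le_max_left _ _).trans_lt hb1⟩,
    ⟨ha2.trans_le (min_le_right _ _), (le_max_right _ _).trans_lt hb1⟩⟩

/-- A solution of a homogeneous linear system that vanishes at one point vanishes identically. -/
theorem eq_zero_of_linear_ode (hI : IsOpen I) (hIo : I.OrdConnected) {A : ℝ → Matrix ι ι ℝ}
    (hA : ∀ i j, ContinuousOn (fun t => A t i j) I) {v : ℝ → ι → ℝ}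
    (hv : ∀ t ∈ I, ∀ i, HasDerivAt (fun s => v s i) ((A t *ᵥ v t) i) t) {s : ℝ} (hs : s ∈ I)
    (h0 : v s = 0) {t : ℝ} (ht : t ∈ I) : v t = 0 := by
  obtain ⟨a, ha, b, hb, hs', ht'⟩ := exists_Ioo_mem_of_isOpen hI hs ht
  have hsub : Icc a b ⊆ I := hIo.out ha hb
  -- A bound for the sum of all absolute entries on the compact interval is a uniform Lipschitz
  -- constant in the sup norm.
  have hcont : ContinuousOn (fun t => ∑ i, ∑ j, |A t i j|) (Icc a b) :=
    continuousOn_finsetSum _ fun i _ => continuousOn_finsetSum _ fun j _ =>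
      ((hA i j).mono hsub).abs
  obtain ⟨K, hK⟩ := isCompact_Icc.exists_bound_of_continuousOn hcont
  refine ODE_solution_unique_of_mem_Ioo (v := fun t w => A t *ᵥ w) (s := fun _ => univ)
    (K := K.toNNReal) (g := fun _ => 0) ?_ hs'
    (fun u hu => ⟨hasDerivAt_pi.2 (hv u (hsub ⟨hu.1.le, hu.2.le⟩)), mem_univ _⟩)
    (fun u _ => ⟨by simpa using hasDerivAt_const u (0 : ι → ℝ), mem_univ _⟩) h0 ht'
  intro u hu
  refine LipschitzOnWith.of_dist_le_mul fun w _ w' _ => ?_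
  rw [dist_eq_norm, dist_eq_norm, ← Matrix.mulVec_sub]
  have hKu := hK u ⟨hu.1.le, hu.2.le⟩
  rw [Real.norm_eq_abs, abs_of_nonneg (by positivity)] at hKu
  have hK0 : 0 ≤ K := le_trans (by positivity) hKu
  rw [Real.coe_toNNReal _ hK0, pi_norm_le_iff_of_nonneg (by positivity)]
  intro i
  calc ‖(A u *ᵥ (w - w')) i‖ ≤ ∑ j, |A u i j| * ‖w - w'‖ := by
        refine (norm_sum_le _ _).trans (Finset.sum_le_sum fun j _ => ?_)
        rw [norm_mul, Real.norm_eq_abs]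
        exact mul_le_mul_of_nonneg_left (norm_le_pi_norm (w - w') j) (abs_nonneg _)
    _ = (∑ j, |A u i j|) * ‖w - w'‖ := by rw [Finset.sum_mul]
    _ ≤ K * ‖w - w'‖ := by
        refine mul_le_mul_of_nonneg_right (le_trans ?_ hKu) (norm_nonneg _)
        exact Finset.single_le_sum (f := fun i => ∑ j, |A u i j|) (fun _ _ => by positivity)
          (Finset.mem_univ i)

end LinearODE

/-! ### Companion systems, Wronskians and controllability. -/

section Companion

variable {n : ℕ} {c : Fin (n + 1) → ℝ → ℝ} {I : Set ℝ} {φ : Fin (n + 1) → ℝ → ℝ}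

/-- The companion matrix of the operator `u ↦ u⁽ⁿ⁺¹⁾ + c_n u⁽ⁿ⁾ + ⋯ + c_0 u`. -/
def companion (c : Fin (n + 1) → ℝ → ℝ) (t : ℝ) : Matrix (Fin (n + 1)) (Fin (n + 1)) ℝ :=
  Matrix.of <| Fin.snoc (α := fun _ => Fin (n + 1) → ℝ)
    (fun i : Fin n => Pi.single i.succ 1) (fun j => -c j t)

/-- The Wronskian matrix of the functions `φ_k`. -/
def wronskian (φ : Fin (n + 1) → ℝ → ℝ) (t : ℝ) : Matrix (Fin (n + 1)) (Fin (n + 1)) ℝ :=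
  Matrix.of fun i k => iteratedDeriv i (φ k) t

theorem companion_castSucc (t : ℝ) (i : Fin n) :
    companion c t i.castSucc = Pi.single i.succ 1 := by
  ext j; simp [companion]

theorem companion_last (t : ℝ) (j : Fin (n + 1)) : companion c t (Fin.last n) j = -c j t := by
  simp [companion]

theorem companion_mulVec_castSucc (t : ℝ) (v : Fin (n + 1) → ℝ) (i : Fin n) :
    (companion c t *ᵥ v) i.castSucc = v i.succ := by
  simp [Matrix.mulVec, companion_castSucc]

theorem companion_mulVec_last (t : ℝ) (v : Fin (n + 1) → ℝ) :
    (companion c t *ᵥ v) (Fin.last n) = -∑ j, c j t * v j := by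
  simp [Matrix.mulVec, dotProduct, companion_last]

theorem companion_mul_apply (t : ℝ) (M : Matrix (Fin (n + 1)) (Fin (n + 1)) ℝ) (i k) :
    (companion c t * M) i k = (companion c t *ᵥ fun j => M j k) i := rfl

theorem vecMul_companion_succ (t : ℝ) (v : Fin (n + 1) → ℝ) (i : Fin n) :
    (v ᵥ* companion c t) i.succ = v i.castSucc - v (Fin.last n) * c i.succ t := by
  rw [Matrix.vecMul, dotProduct, Fin.sum_univ_castSucc]
  simp [companion_castSucc, companion_last, Pi.single_apply, sub_eq_add_neg]

theorem continuousOn_companion (hc : ∀ i, ContinuousOn (c i) I) (i j : Fin (n + 1)) :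
    ContinuousOn (fun t => companion c t i j) I := by
  induction i using Fin.lastCases with
  | last => simp only [companion_last]; exact (hc j).neg
  | cast i => simpa [companion_castSucc] using continuousOn_const

theorem IsFundamentalSystem.hasEntryDerivAt_wronskian (hI : IsOpen I)
    (hφ : IsFundamentalSystem c I φ) {t : ℝ} (ht : t ∈ I) :
    HasEntryDerivAt (wronskian φ) (companion c t * wronskian φ t) t := by
  have key : ∀ (i : Fin (n + 1)) k,
      HasDerivAt (iteratedDeriv i (φ k)) (iteratedDeriv (i + 1) (φ k) t) t := by
    intro i k
    have h1 := (hφ.smooth k).differentiableOn_iteratedDerivWithin (m := i)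
      (by exact_mod_cast i.2) hI.uniqueDiffOn
    have h2 : DifferentiableAt ℝ (iteratedDeriv i (φ k)) t := by
      refine ((h1 t ht).differentiableAt (hI.mem_nhds ht)).congr_of_eventuallyEq ?_
      filter_upwards [hI.mem_nhds ht] with s hs
      exact (iteratedDerivWithin_of_isOpen hI hs).symm
    rw [iteratedDeriv_succ]
    exact h2.hasDerivAt
  intro i k
  refine (key i k).congr_deriv ?_
  rw [companion_mul_apply]
  induction i using Fin.lastCases with
  | last =>
    rw [companion_mulVec_last]
    have := hφ.solves k t ht
    simp only [wronskian, Matrix.of_apply, Fin.val_last]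
    linarith
  | cast i =>
    rw [companion_mulVec_castSucc]
    simp [wronskian]

/-- A kernel vector at one time gives a solution with zero initial state; by uniqueness it vanishes
throughout, and its zeroth row is a linear relation between the solutions. -/
theorem IsFundamentalSystem.det_wronskian_ne_zero (hI : IsOpen I) (hIo : I.OrdConnected)
    (hc : ∀ i, ContinuousOn (c i) I) (hφ : IsFundamentalSystem c I φ) {t : ℝ} (ht : t ∈ I) :
    (wronskian φ t).det ≠ 0 := by
  intro hdet
  obtain ⟨κ, hκ, h0⟩ := Matrix.exists_mulVec_eq_zero_iff.2 hdet
  refine hκ ?_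
  have hz : ∀ s ∈ I, wronskian φ s *ᵥ κ = 0 := by
    intro s hs
    refine eq_zero_of_linear_ode hI hIo (continuousOn_companion hc)
      (v := fun s => wronskian φ s *ᵥ κ) (fun u hu i => ?_) ht h0 hs
    refine ((hφ.hasEntryDerivAt_wronskian hI hu).mulVec (v := fun _ => κ)
      (v' := 0) (fun k => by simpa using hasDerivAt_const u (κ k)) i).congr_deriv ?_
    simp
  have hli := Fintype.linearIndependent_iff.1 hφ.linearIndependent κ ?_
  · ext k; exact hli k
  · ext ⟨s, hs⟩
    have := congrFun (hz s hs) 0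
    simpa [Matrix.mulVec, dotProduct, wronskian, mul_comm] using this

theorem IsFundamentalSystem.hasEntryDerivAt_inv_wronskian (hI : IsOpen I) (hIo : I.OrdConnected)
    (hc : ∀ i, ContinuousOn (c i) I) (hφ : IsFundamentalSystem c I φ) {t : ℝ} (ht : t ∈ I) :
    HasEntryDerivAt (fun s => (wronskian φ s)⁻¹) (-((wronskian φ t)⁻¹ * companion c t)) t := by
  have hd := hφ.det_wronskian_ne_zero hI hIo hc ht
  refine ((hφ.hasEntryDerivAt_wronskian hI ht).inv hd).congr_deriv ?_
  rw [Matrix.mul_assoc, Matrix.mul_assoc, Matrix.mul_nonsing_inv _ (isUnit_iff_ne_zero.2 hd),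
    Matrix.mul_one]

/-- Solutions that are linearly dependent on a nonempty open subset have trivial coefficients. -/
theorem IsFundamentalSystem.eq_zero_of_eqOn_open (hI : IsOpen I) (hIo : I.OrdConnected)
    (hc : ∀ i, ContinuousOn (c i) I) (hφ : IsFundamentalSystem c I φ) {O : Set ℝ} (hO : IsOpen O)
    (hOI : O ⊆ I) (hne : O.Nonempty) {κ : Fin (n + 1) → ℝ}
    (h : ∀ t ∈ O, ∑ k, κ k * φ k t = 0) : κ = 0 := by
  -- Each row is the derivative of the row above, so vanishing on an open set passes down.
  have hz : ∀ i : Fin (n + 1), ∀ t ∈ O, (wronskian φ t *ᵥ κ) i = 0 := by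
    intro i
    induction i using Fin.induction with
    | zero =>
      intro t ht
      have := h t ht
      simpa [Matrix.mulVec, dotProduct, wronskian, mul_comm] using this
    | succ i ih =>
      intro t ht
      have h1 := (hφ.hasEntryDerivAt_wronskian hI (hOI ht)).mulVec (v := fun _ => κ)
        (v' := 0) (fun k => by simpa using hasDerivAt_const t (κ k)) i.castSucc
      have h2 : HasDerivAt (fun s => (wronskian φ s *ᵥ κ) i.castSucc) 0 t :=
        (hasDerivAt_const t (0 : ℝ)).congr_of_eventuallyEq <| by
          filter_upwards [hO.mem_nhds ht] with s hs using ih s hs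
      have h3 := h1.unique h2
      rwa [Matrix.mulVec_zero, add_zero, ← Matrix.mulVec_mulVec,
        companion_mulVec_castSucc] at h3
  obtain ⟨t, ht⟩ := hne
  by_contra hκ
  exact hφ.det_wronskian_ne_zero hI hIo hc (hOI ht)
    (Matrix.exists_mulVec_eq_zero_iff.1 ⟨κ, hκ, funext fun i => hz i t ht⟩)

/-- Controllability: the last column of the inverse Wronskian matrix is not confined to a
hyperplane on any nonempty open set. -/
theorem IsFundamentalSystem.eq_zero_of_vecMul_inv_last (hI : IsOpen I) (hIo : I.OrdConnected)
    (hc : ∀ i, ContinuousOn (c i) I) (hφ : IsFundamentalSystem c I φ) {O : Set ℝ} (hO : IsOpen O)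
    (hOI : O ⊆ I) (hne : O.Nonempty) {κ : Fin (n + 1) → ℝ}
    (h : ∀ t ∈ O, (κ ᵥ* (wronskian φ t)⁻¹) (Fin.last n) = 0) : κ = 0 := by
  -- Differentiating component i+1 yields, up to sign, component i minus a multiple of the last one,
  -- which is zero; hence the descending induction.
  have hz : ∀ i : Fin (n + 1), ∀ t ∈ O, (κ ᵥ* (wronskian φ t)⁻¹) i = 0 := by
    intro i
    induction i using Fin.reverseInduction with
    | last => exact h
    | cast i ih =>
      intro t ht
      have h1 := (hφ.hasEntryDerivAt_inv_wronskian hI hIo hc (hOI ht)).transpose.mulVec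
        (v := fun _ => κ) (v' := 0) (fun k => by simpa using hasDerivAt_const t (κ k)) i.succ
      have h2 : HasDerivAt (fun s => (((wronskian φ s)⁻¹)ᵀ *ᵥ κ) i.succ) 0 t :=
        (hasDerivAt_const t (0 : ℝ)).congr_of_eventuallyEq <| by
          filter_upwards [hO.mem_nhds ht] with s hs
          rw [Matrix.mulVec_transpose]
          exact ih s hs
      have h3 := h1.unique h2
      rw [Matrix.mulVec_zero, add_zero, Matrix.mulVec_transpose, Matrix.vecMul_neg,
        Pi.neg_apply, neg_eq_zero, ← Matrix.vecMul_vecMul, vecMul_companion_succ, h t ht] at h3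
      simpa using h3
  obtain ⟨t, ht⟩ := hne
  have h1 : κ ᵥ* (wronskian φ t)⁻¹ = 0 := funext fun i => hz i t ht
  have hd := hφ.det_wronskian_ne_zero hI hIo hc (hOI ht)
  calc κ = κ ᵥ* (wronskian φ t)⁻¹ ᵥ* wronskian φ t := by
        rw [Matrix.vecMul_vecMul, Matrix.nonsing_inv_mul _ (isUnit_iff_ne_zero.2 hd),
          Matrix.vecMul_one]
    _ = 0 := by rw [h1, Matrix.zero_vecMul]

end Companion

/-! ### Variation of constants for state covariances. -/

section Transition

variable {Ω : Type*} [MeasurableSpace Ω] {P : Measure Ω} [IsProbabilityMeasure P]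
  {n : ℕ} {c : Fin (n + 1) → ℝ → ℝ} {I J : Set ℝ} {y B : ℝ → Ω → ℝ}
  {φ : Fin (n + 1) → ℝ → ℝ}

/-- The covariances of the random variable `Z` with the components of the state at time `t`. -/
def covState (n : ℕ) (P : Measure Ω) (J : Set ℝ) (y : ℝ → Ω → ℝ) (Z : Ω → ℝ) (t : ℝ) :
    Fin (n + 1) → ℝ :=
  fun i => cov[Z, state J y i t; P]

/-- The time domain `J` of the process, an open interval `I` inside it and the forward equation. -/
structure ForwardData (c : Fin (n + 1) → ℝ → ℝ) (I J : Set ℝ) (P : Measure Ω)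
    (y B : ℝ → Ω → ℝ) : Prop where
  isOpen : IsOpen I
  ordConnected : I.OrdConnected
  ordConnected' : J.OrdConnected
  uniqueDiffOn : UniqueDiffOn ℝ J
  subset : I ⊆ J
  continuousOn : ∀ i, ContinuousOn (c i) J
  solution : IsForwardSolution c J P y B

/-- If the covariance of `Z` with the noise has density `g`, then `g` forces the companion system.
The top state has no path derivative, so the last component comes from the integrated equation and
the fundamental theorem of calculus. -/
theorem ForwardData.hasDerivAt_covState (h : ForwardData c I J P y B) {Z : Ω → ℝ}
    (hZ : MemLp Z 2 P) {g : ℝ → ℝ} {a b : ℝ} (ha : a ∈ I) (hb : b ∈ I)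
    (hg : ContinuousOn g (Icc a b))
    (hZg : ∀ u ∈ Icc a b, cov[Z, increment B a u; P] = ∫ r in a..u, g r) {t : ℝ}
    (ht : t ∈ Ioo a b) (i : Fin (n + 1)) :
    HasDerivAt (fun u => covState n P J y Z u i)
      ((companion c t *ᵥ covState n P J y Z t +
        Pi.single (M := fun _ => ℝ) (Fin.last n) (g t)) i) t := by
  have hsub : Icc a b ⊆ J := (h.ordConnected.out ha hb).trans h.subset
  have htI : t ∈ I := h.ordConnected.out ha hb ⟨ht.1.le, ht.2.le⟩
  have hJt : J ∈ 𝓝 t := mem_of_superset (h.isOpen.mem_nhds htI) h.subset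
  induction i using Fin.lastCases with
  | cast i =>
    have h1 := (h.solution.hasDerivWithinAt_cov_state h.uniqueDiffOn hZ i
      (h.subset htI)).hasDerivAt hJt
    refine h1.congr_deriv ?_
    rw [Pi.add_apply, companion_mulVec_castSucc, Pi.single_eq_of_ne (Fin.castSucc_ne_last i),
      add_zero]
    rfl
  | last =>
    set f : ℝ → ℝ := fun u => ∑ i, c i u * cov[Z, state J y i u; P] with hf
    have hfc : ContinuousOn f (Icc a b) := continuousOn_finsetSum _ fun i _ =>
      ((h.continuousOn i).mul (h.solution.continuousOn_cov_state h.uniqueDiffOn hZ i)).mono hsub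
    have hint : ∀ {q : ℝ → ℝ}, ContinuousOn q (Icc a b) →
        HasDerivAt (fun u => ∫ r in a..u, q r) (q t) t := by
      intro q hq
      have hnhds : Icc a b ∈ 𝓝 t := Icc_mem_nhds ht.1 ht.2
      refine intervalIntegral.integral_hasDerivAt_right
        ((hq.mono ?_).intervalIntegrable) ?_ (hq.continuousAt hnhds)
      · rw [uIcc_of_le ht.1.le]; exact Icc_subset_Icc_right ht.2.le
      · exact ⟨Icc a b, hnhds, hq.aestronglyMeasurable measurableSet_Icc⟩
    have hev : (fun u => covState n P J y Z u (Fin.last n)) =ᶠ[𝓝 t] fun u =>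
        ((∫ r in a..u, g r) - ∫ r in a..u, f r) + cov[Z, state J y n a; P] := by
      filter_upwards [Ioo_mem_nhds ht.1 ht.2] with u hu
      have h1 := h.solution.cov_increment h.ordConnected' h.uniqueDiffOn h.continuousOn hZ
        (h.subset ha) (hsub ⟨hu.1.le, hu.2.le⟩) hu.1.le
      rw [hZg u ⟨hu.1.le, hu.2.le⟩] at h1
      simp only [covState, Fin.val_last]
      rw [h1]; ring
    refine ((((hint hg).sub (hint hfc)).add_const _).congr_of_eventuallyEq hev).congr_deriv ?_
    rw [Pi.add_apply, companion_mulVec_last, Pi.single_eq_same, hf]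
    simp only [covState]
    ring

theorem ForwardData.continuousOn_covState (h : ForwardData c I J P y B) {Z : Ω → ℝ}
    (hZ : MemLp Z 2 P) (i : Fin (n + 1)) : ContinuousOn (fun u => covState n P J y Z u i) J :=
  h.solution.continuousOn_cov_state h.uniqueDiffOn hZ i

theorem ForwardData.continuousOn_coeff (h : ForwardData c I J P y B) (i : Fin (n + 1)) :
    ContinuousOn (c i) I :=
  (h.continuousOn i).mono h.subset

theorem ForwardData.det_ne_zero (h : ForwardData c I J P y B) (hφ : IsFundamentalSystem c I φ)
    {t : ℝ} (ht : t ∈ I) : (wronskian φ t).det ≠ 0 :=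
  hφ.det_wronskian_ne_zero h.isOpen h.ordConnected h.continuousOn_coeff ht

theorem ForwardData.hasEntryDerivAt_inv (h : ForwardData c I J P y B)
    (hφ : IsFundamentalSystem c I φ) {t : ℝ} (ht : t ∈ I) :
    HasEntryDerivAt (fun s => (wronskian φ s)⁻¹) (-((wronskian φ t)⁻¹ * companion c t)) t :=
  hφ.hasEntryDerivAt_inv_wronskian h.isOpen h.ordConnected h.continuousOn_coeff ht

theorem ForwardData.continuousOn_inv (h : ForwardData c I J P y B)
    (hφ : IsFundamentalSystem c I φ) (i j : Fin (n + 1)) :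
    ContinuousOn (fun t => (wronskian φ t)⁻¹ i j) I := fun _ ht =>
  (h.hasEntryDerivAt_inv hφ ht i j).continuousAt.continuousWithinAt

/-- Variation of constants for the covariances with the state. -/
theorem ForwardData.inv_mulVec_covState_sub (h : ForwardData c I J P y B)
    (hφ : IsFundamentalSystem c I φ) {Z : Ω → ℝ}
    (hZ : MemLp Z 2 P) {g : ℝ → ℝ} {a b : ℝ} (ha : a ∈ I) (hb : b ∈ I) (hab : a ≤ b)
    (hg : ContinuousOn g (Icc a b))
    (hZg : ∀ u ∈ Icc a b, cov[Z, increment B a u; P] = ∫ r in a..u, g r) (k : Fin (n + 1)) :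
    ((wronskian φ b)⁻¹ *ᵥ covState n P J y Z b) k - ((wronskian φ a)⁻¹ *ᵥ covState n P J y Z a) k
      = ∫ u in a..b, (wronskian φ u)⁻¹ k (Fin.last n) * g u := by
  have hsub : Icc a b ⊆ I := h.ordConnected.out ha hb
  have hgc : ContinuousOn (fun u => (wronskian φ u)⁻¹ k (Fin.last n) * g u) (Icc a b) :=
    ((h.continuousOn_inv hφ k _).mono hsub).mul hg
  refine (intervalIntegral.integral_eq_sub_of_hasDerivAt_of_le hab (f := fun u =>
    ((wronskian φ u)⁻¹ *ᵥ covState n P J y Z u) k) ?_ (fun u hu => ?_) ?_).symm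
  · simp only [Matrix.mulVec, dotProduct]
    exact continuousOn_finsetSum _ fun i _ => ((h.continuousOn_inv hφ k i).mono hsub).mul
      ((h.continuousOn_covState hZ i).mono (hsub.trans h.subset))
  · have hu' : u ∈ I := hsub ⟨hu.1.le, hu.2.le⟩
    refine ((h.hasEntryDerivAt_inv hφ hu').mulVec
      (h.hasDerivAt_covState hZ ha hb hg hZg hu) k).congr_deriv ?_
    simp [Matrix.mulVec_add, Matrix.neg_mulVec, Matrix.mulVec_mulVec, mul_comm]
  · exact (hgc.mono (by rw [uIcc_of_le hab])).intervalIntegrable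

theorem ForwardData.inv_mulVec_covState_eq (h : ForwardData c I J P y B)
    (hφ : IsFundamentalSystem c I φ) {Z : Ω → ℝ}
    (hZ : MemLp Z 2 P) {a b : ℝ} (ha : a ∈ I) (hb : b ∈ I) (hab : a ≤ b)
    (hZg : ∀ u ∈ Icc a b, cov[Z, increment B a u; P] = 0) :
    (wronskian φ b)⁻¹ *ᵥ covState n P J y Z b = (wronskian φ a)⁻¹ *ᵥ covState n P J y Z a := by
  ext k
  have h1 := h.inv_mulVec_covState_sub hφ hZ ha hb hab (g := fun _ => 0) continuousOn_const
    (fun u hu => by simp [hZg u hu]) k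
  simpa [sub_eq_zero] using h1

/-- The matrix `Q(t) Π(t)`, where `Q` is the inverse Wronskian matrix. -/
def gainMatrix (n : ℕ) (P : Measure Ω) (J : Set ℝ) (y : ℝ → Ω → ℝ) (φ : Fin (n + 1) → ℝ → ℝ)
    (t : ℝ) : Matrix (Fin (n + 1)) (Fin (n + 1)) ℝ :=
  (wronskian φ t)⁻¹ * stateCov (n + 1) J P y t

/-- A state at `s` is uncorrelated with noise after `s`, so the transformed covariance keeps its
value at `s`. -/
theorem ForwardData.inv_mulVec_covState_of_le (h : ForwardData c I J P y B)
    (hφ : IsFundamentalSystem c I φ) {s t : ℝ} (hs : s ∈ I) (ht : t ∈ I) (hst : s ≤ t)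
    (j k : Fin (n + 1)) :
    ((wronskian φ t)⁻¹ *ᵥ covState n P J y (state J y j s) t) k = gainMatrix n P J y φ s k j := by
  rw [h.inv_mulVec_covState_eq hφ (h.solution.memLp_state (h.subset hs) j) hs ht hst]
  · simp only [Matrix.mulVec, dotProduct, covState, gainMatrix, Matrix.mul_apply, stateCov,
      Matrix.of_apply]
    exact Finset.sum_congr rfl fun i _ => by rw [covariance_comm]
  · intro u hu
    exact h.solution.cov_state_increment (h.subset hs) (h.subset hs)
      (h.subset (h.ordConnected.out hs ht hu)) le_rfl hu.1 j

/-- The covariance of the states at two times. -/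
theorem ForwardData.cov_state_state (h : ForwardData c I J P y B)
    (hφ : IsFundamentalSystem c I φ) {s t : ℝ} (hs : s ∈ I) (ht : t ∈ I) (hst : s ≤ t)
    (i j : Fin (n + 1)) :
    cov[state J y j s, state J y i t; P] = (wronskian φ t * gainMatrix n P J y φ s) i j := by
  have h1 : (wronskian φ t)⁻¹ *ᵥ covState n P J y (state J y j s) t =
      fun k => gainMatrix n P J y φ s k j :=
    funext fun k => h.inv_mulVec_covState_of_le hφ hs ht hst j k
  have h2 := congrArg (wronskian φ t *ᵥ ·) h1
  simp only [Matrix.mulVec_mulVec,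
    Matrix.mul_nonsing_inv _ (isUnit_iff_ne_zero.2 (h.det_ne_zero hφ ht)), Matrix.one_mulVec] at h2
  exact congrFun h2 i

/-- The increment starts uncorrelated with the state at `s`, has noise density 1 up to `u` and
density 0 afterwards. -/
theorem ForwardData.inv_mulVec_covState_increment (h : ForwardData c I J P y B)
    (hφ : IsFundamentalSystem c I φ) {s u t : ℝ} (hs : s ∈ I) (hu : u ∈ I) (ht : t ∈ I)
    (hsu : s ≤ u) (hut : u ≤ t) (k : Fin (n + 1)) :
    ((wronskian φ t)⁻¹ *ᵥ covState n P J y (increment B s u) t) k =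
      ∫ r in s..u, (wronskian φ r)⁻¹ k (Fin.last n) := by
  have hZ := h.solution.memLp_increment (h.subset hs) (h.subset hu) hsu
  rw [h.inv_mulVec_covState_eq hφ hZ hu ht hut]
  · have h1 := h.inv_mulVec_covState_sub hφ hZ hs hu hsu (g := fun _ => 1) continuousOn_const
      (fun r hr => by
        have hr' := h.ordConnected.out hs hu hr
        rw [h.solution.cov_increment_increment h.ordConnected' h.uniqueDiffOn h.continuousOn
          (h.subset hs) (h.subset hs) (h.subset hr') (h.subset hu) le_rfl hr.1 hr.2]
        simp) k
    have h2 : covState n P J y (increment B s u) s = 0 := funext fun i =>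
      h.solution.cov_increment_state (h.subset hs) (h.subset hs) (h.subset hu) le_rfl hsu i
    rw [h2, Matrix.mulVec_zero] at h1
    simpa using h1
  · intro r hr
    have hr' := h.ordConnected.out hu ht hr
    rw [covariance_comm]
    exact h.solution.cov_increment_increment_of_le h.ordConnected' h.uniqueDiffOn h.continuousOn
      (h.subset hs) (h.subset hu) (h.subset hu) (h.subset hr') hsu le_rfl hr.1

theorem ForwardData.hasEntryDerivAt_gainMatrix (h : ForwardData c I J P y B)
    (hφ : IsFundamentalSystem c I φ) {t : ℝ} (ht : t ∈ I) :
    HasEntryDerivAt (fun s => (gainMatrix n P J y φ s)ᵀ)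
      (companion c t * (gainMatrix n P J y φ t)ᵀ + Matrix.of fun i k =>
        Pi.single (M := fun _ => ℝ) (Fin.last n) ((wronskian φ t)⁻¹ k (Fin.last n)) i) t := by
  obtain ⟨a, ha, b, hb, htab, -⟩ := exists_Ioo_mem_of_isOpen h.isOpen ht ht
  have hsub : Icc a b ⊆ I := h.ordConnected.out ha hb
  intro j k
  -- Test variable: the k-th coordinate of Q(b) applied to the state at the later time `b`. Its
  -- covariances with earlier states form row k of the gain matrix and its noise density is the
  -- entry (k, last) of Q, so `ForwardData.hasDerivAt_covState` gives the derivative without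
  -- differentiating Π.
  set Z : Ω → ℝ := ∑ i, (wronskian φ b)⁻¹ k i • state J y i b with hZdef
  have hm : ∀ i : Fin (n + 1), MemLp ((wronskian φ b)⁻¹ k i • state J y i b) 2 P := fun i =>
    (h.solution.memLp_state (h.subset hb) i).const_smul _
  have hZ : MemLp Z 2 P := memLp_finsetSum' _ fun i _ => hm i
  have hcov : ∀ {Y : Ω → ℝ}, MemLp Y 2 P →
      cov[Z, Y; P] = ((wronskian φ b)⁻¹ *ᵥ covState n P J y Y b) k := by
    intro Y hY
    rw [hZdef, covariance_sum_left hm hY]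
    simp only [covariance_smul_left, Matrix.mulVec, dotProduct, covState]
    exact Finset.sum_congr rfl fun i _ => by rw [covariance_comm]
  have hG : ∀ s ∈ Icc a b, covState n P J y Z s = gainMatrix n P J y φ s k := by
    intro s hs
    ext i
    rw [covState, hcov (h.solution.memLp_state (h.subset (hsub hs)) i),
      h.inv_mulVec_covState_of_le hφ (hsub hs) hb hs.2]
  have hd := h.hasDerivAt_covState hZ ha hb ((h.continuousOn_inv hφ k (Fin.last n)).mono hsub)
    (fun u hu => by
      rw [hcov (h.solution.memLp_increment (h.subset ha) (h.subset (hsub hu)) hu.1)]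
      exact h.inv_mulVec_covState_increment hφ ha (hsub hu) hb hu.1 hu.2 k) htab j
  rw [hG t ⟨htab.1.le, htab.2.le⟩] at hd
  refine hd.congr_of_eventuallyEq ?_
  filter_upwards [Ioo_mem_nhds htab.1 htab.2] with s hs
  rw [hG s ⟨hs.1.le, hs.2.le⟩, Matrix.transpose_apply]

end Transition

/-! ### Nondegeneracy, the backward equation and factorization of the kernel. -/

section Factorization

variable {Ω : Type*} [MeasurableSpace Ω] {P : Measure Ω} [IsProbabilityMeasure P]
  {n : ℕ} {c : Fin (n + 1) → ℝ → ℝ} {I J : Set ℝ} {y B : ℝ → Ω → ℝ}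
  {φ ψ : Fin (n + 1) → ℝ → ℝ}

theorem stateCov_transpose (t : ℝ) :
    (stateCov (n + 1) J P y t)ᵀ = stateCov (n + 1) J P y t := by
  ext i j
  simp [stateCov, covariance_comm]

theorem IsForwardSolution.dotProduct_stateCov_nonneg (hy : IsForwardSolution c J P y B) {t : ℝ}
    (ht : t ∈ J) (v : Fin (n + 1) → ℝ) : 0 ≤ v ⬝ᵥ stateCov (n + 1) J P y t *ᵥ v := by
  have hm : ∀ i : Fin (n + 1), MemLp (v i • state J y i t) 2 P := fun i =>
    (hy.memLp_state ht i).const_smul _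
  have h := variance_nonneg (∑ i, v i • state J y i t) P
  rw [← covariance_self (memLp_finsetSum' _ fun i _ => hm i).aemeasurable,
    covariance_sum_sum hm hm] at h
  refine h.trans_eq ?_
  simp only [dotProduct, Matrix.mulVec, Finset.mul_sum, covariance_smul_left,
    covariance_smul_right, stateCov, Matrix.of_apply]
  exact Finset.sum_congr rfl fun i _ => Finset.sum_congr rfl fun j _ => by ring

/-- The covariance matrix `Q(t) Π(t) Q(t)ᵀ` of the state in the coordinates given by the
fundamental system. -/
def spreadMatrix (n : ℕ) (P : Measure Ω) (J : Set ℝ) (y : ℝ → Ω → ℝ) (φ : Fin (n + 1) → ℝ → ℝ)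
    (t : ℝ) : Matrix (Fin (n + 1)) (Fin (n + 1)) ℝ :=
  gainMatrix n P J y φ t * ((wronskian φ t)⁻¹)ᵀ

theorem gainMatrix_transpose (t : ℝ) :
    (gainMatrix n P J y φ t)ᵀ = stateCov (n + 1) J P y t * ((wronskian φ t)⁻¹)ᵀ := by
  rw [gainMatrix, Matrix.transpose_mul, stateCov_transpose]

theorem inv_mul_gainMatrix_transpose (t : ℝ) :
    (wronskian φ t)⁻¹ * (gainMatrix n P J y φ t)ᵀ = spreadMatrix n P J y φ t := by
  rw [gainMatrix_transpose, spreadMatrix, gainMatrix, Matrix.mul_assoc]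

/-- In the coordinates given by Q the drift terms cancel; only the rank one contribution of the
noise remains. -/
theorem ForwardData.hasEntryDerivAt_spreadMatrix (h : ForwardData c I J P y B)
    (hφ : IsFundamentalSystem c I φ) {t : ℝ} (ht : t ∈ I) :
    HasEntryDerivAt (spreadMatrix n P J y φ) (Matrix.of fun k l =>
      (wronskian φ t)⁻¹ k (Fin.last n) * (wronskian φ t)⁻¹ l (Fin.last n)) t := by
  refine ((h.hasEntryDerivAt_gainMatrix hφ ht).transpose.mul
    (h.hasEntryDerivAt_inv hφ ht).transpose).congr_deriv ?_
  rw [Matrix.transpose_add, Matrix.transpose_mul, Matrix.transpose_transpose, Matrix.add_mul,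
    Matrix.transpose_neg, Matrix.transpose_mul, Matrix.mul_neg, Matrix.mul_assoc,
    add_right_comm, add_neg_cancel, zero_add]
  ext k l
  simp [Matrix.mul_apply, Pi.single_apply]

theorem ForwardData.hasDerivAt_dotProduct_spreadMatrix (h : ForwardData c I J P y B)
    (hφ : IsFundamentalSystem c I φ) (v : Fin (n + 1) → ℝ) {t : ℝ} (ht : t ∈ I) :
    HasDerivAt (fun s => v ⬝ᵥ spreadMatrix n P J y φ s *ᵥ v)
      ((v ᵥ* (wronskian φ t)⁻¹) (Fin.last n) ^ 2) t := by
  have h1 := fun k => (h.hasEntryDerivAt_spreadMatrix hφ ht).mulVec (v := fun _ => v)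
    (v' := 0) (fun k => by simpa using hasDerivAt_const t (v k)) k
  have h2 : HasDerivAt (fun s => ∑ k, v k * (spreadMatrix n P J y φ s *ᵥ v) k) _ t :=
    HasDerivAt.fun_sum fun k _ => (h1 k).const_mul (v k)
  refine h2.congr_deriv ?_
  simp only [Matrix.mulVec_zero, add_zero, Matrix.mulVec, Matrix.vecMul, dotProduct,
    Matrix.of_apply, sq, Finset.mul_sum, Finset.sum_mul]
  rw [Finset.sum_comm]
  exact Finset.sum_congr rfl fun i _ => Finset.sum_congr rfl fun j _ => by ring

/-- The derivative of the quadratic form is a square. If it is zero on an open set, `v` is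
orthogonal there to the last column of Q, which controllability forbids unless `v = 0`. -/
theorem ForwardData.eq_zero_of_dotProduct_spreadMatrix_const (h : ForwardData c I J P y B)
    (hφ : IsFundamentalSystem c I φ) {O : Set ℝ} (hO : IsOpen O) (hOI : O ⊆ I)
    (hne : O.Nonempty) {v : Fin (n + 1) → ℝ} {r : ℝ}
    (hv : ∀ t ∈ O, v ⬝ᵥ spreadMatrix n P J y φ t *ᵥ v = r) : v = 0 := by
  refine hφ.eq_zero_of_vecMul_inv_last h.isOpen h.ordConnected h.continuousOn_coeff hO hOI hne
    fun t ht => ?_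
  have h1 := h.hasDerivAt_dotProduct_spreadMatrix hφ v (hOI ht)
  have h2 : HasDerivAt (fun s => v ⬝ᵥ spreadMatrix n P J y φ s *ᵥ v) 0 t :=
    (hasDerivAt_const t r).congr_of_eventuallyEq <| by
      filter_upwards [hO.mem_nhds ht] with s hs using hv s hs
  exact pow_eq_zero_iff two_ne_zero |>.1 (h1.unique h2)

theorem ForwardData.dotProduct_spreadMatrix_nonneg (h : ForwardData c I J P y B) {t : ℝ}
    (ht : t ∈ I) (v : Fin (n + 1) → ℝ) : 0 ≤ v ⬝ᵥ spreadMatrix n P J y φ t *ᵥ v := by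
  have h1 := h.solution.dotProduct_stateCov_nonneg (h.subset ht) (((wronskian φ t)⁻¹)ᵀ *ᵥ v)
  rwa [spreadMatrix, gainMatrix, ← Matrix.mulVec_mulVec, ← Matrix.mulVec_mulVec,
    Matrix.dotProduct_mulVec, ← Matrix.mulVec_transpose]

theorem ForwardData.det_spreadMatrix_ne_zero (h : ForwardData c I J P y B)
    (hφ : IsFundamentalSystem c I φ) {t : ℝ} (ht : t ∈ I) :
    (spreadMatrix n P J y φ t).det ≠ 0 := by
  intro hdet
  obtain ⟨v, hv, h0⟩ := Matrix.exists_mulVec_eq_zero_iff.2 hdet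
  refine hv ?_
  obtain ⟨a, ha, b, hb, htab, -⟩ := exists_Ioo_mem_of_isOpen h.isOpen ht ht
  have hsub : Icc a t ⊆ I := h.ordConnected.out ha ht
  -- The form is nonnegative and nondecreasing in time, so a null vector at `t` makes it zero on the
  -- whole interval from `a` to `t`.
  have hmono : MonotoneOn (fun s => v ⬝ᵥ spreadMatrix n P J y φ s *ᵥ v) (Icc a t) := by
    refine monotoneOn_of_deriv_nonneg (convex_Icc _ _) (fun s hs => ?_) (fun s hs => ?_)
      fun s hs => ?_
    · exact (h.hasDerivAt_dotProduct_spreadMatrix hφ v (hsub hs)).continuousAt.continuousWithinAt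
    · exact (h.hasDerivAt_dotProduct_spreadMatrix hφ v
        (hsub (interior_subset hs))).differentiableAt.differentiableWithinAt
    · rw [(h.hasDerivAt_dotProduct_spreadMatrix hφ v (hsub (interior_subset hs))).deriv]
      positivity
  refine h.eq_zero_of_dotProduct_spreadMatrix_const hφ (isOpen_Ioo (a := a) (b := t)) (r := 0)
    (Ioo_subset_Icc_self.trans hsub) (nonempty_Ioo.2 htab.1) fun s hs => ?_
  refine le_antisymm ?_ (h.dotProduct_spreadMatrix_nonneg (hsub (Ioo_subset_Icc_self hs)) v)
  have := hmono (Ioo_subset_Icc_self hs) (right_mem_Icc.2 htab.1.le) hs.2.le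
  simpa [h0] using this

theorem ForwardData.det_stateCov_ne_zero (h : ForwardData c I J P y B)
    (hφ : IsFundamentalSystem c I φ) {t : ℝ} (ht : t ∈ I) :
    (stateCov (n + 1) J P y t).det ≠ 0 := by
  have h1 := h.det_spreadMatrix_ne_zero hφ ht
  rw [spreadMatrix, gainMatrix, Matrix.det_mul, Matrix.det_mul] at h1
  exact right_ne_zero_of_mul (left_ne_zero_of_mul h1)

theorem ForwardData.continuousOn_backwardCoeff (h : ForwardData c I J P y B)
    (hφ : IsFundamentalSystem c I φ) (i : Fin (n + 1)) :
    ContinuousOn (backwardCoeff c J P y i) I := by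
  intro t ht
  -- Π is recovered as Wronskian times gain matrix, which shows that it is differentiable.
  have h1 := (hφ.hasEntryDerivAt_wronskian h.isOpen ht).mul
    (h.hasEntryDerivAt_gainMatrix hφ ht).transpose
  have h2 : HasEntryDerivAt (stateCov (n + 1) J P y) _ t := fun i j =>
    (h1 i j).congr_of_eventuallyEq <| by
      filter_upwards [h.isOpen.mem_nhds ht] with s hs
      rw [Matrix.transpose_transpose, gainMatrix, ← Matrix.mul_assoc,
        Matrix.mul_nonsing_inv _ (isUnit_iff_ne_zero.2 (h.det_ne_zero hφ hs)), Matrix.one_mul]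
  exact (h.continuousOn_coeff i t ht).sub
    (h2.inv (h.det_stateCov_ne_zero hφ ht) _ i).continuousAt.continuousWithinAt

/-- The transposed gain matrix solves the backward equation. -/
theorem ForwardData.hasEntryDerivAt_gainMatrix_backward (h : ForwardData c I J P y B)
    (hφ : IsFundamentalSystem c I φ) {t : ℝ} (ht : t ∈ I) :
    HasEntryDerivAt (fun s => (gainMatrix n P J y φ s)ᵀ)
      (companion (backwardCoeff c J P y) t * (gainMatrix n P J y φ t)ᵀ) t := by
  refine (h.hasEntryDerivAt_gainMatrix hφ ht).congr_deriv ?_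
  ext i k
  rw [Matrix.add_apply, companion_mul_apply, companion_mul_apply, Matrix.of_apply]
  induction i using Fin.lastCases with
  | cast i =>
    rw [companion_mulVec_castSucc, companion_mulVec_castSucc,
      Pi.single_eq_of_ne (Fin.castSucc_ne_last i), add_zero]
  | last =>
    -- Since Π⁻¹(QΠ)ᵀ = Qᵀ, the noise term in the last row is exactly the Π⁻¹ correction in the
    -- backward coefficients.
    have h1 : (stateCov (n + 1) J P y t)⁻¹ * (gainMatrix n P J y φ t)ᵀ =
        ((wronskian φ t)⁻¹)ᵀ := by
      rw [gainMatrix_transpose, ← Matrix.mul_assoc,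
        Matrix.nonsing_inv_mul _ (isUnit_iff_ne_zero.2 (h.det_stateCov_ne_zero hφ ht)),
        Matrix.one_mul]
    have h2 := congrFun (congrFun h1 (Fin.last n)) k
    rw [Matrix.mul_apply, Matrix.transpose_apply] at h2
    rw [companion_mulVec_last, companion_mulVec_last, Pi.single_eq_same, ← h2]
    simp only [backwardCoeff, sub_mul, Finset.sum_sub_distrib]
    have e : (⟨n + 1 - 1, Nat.sub_lt (Nat.succ_pos n) one_pos⟩ : Fin (n + 1)) = Fin.last n := rfl
    simp only [e]
    ring

/-- Both sides are invertible matrix solutions of one linear system, so their quotient has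
derivative zero. -/
theorem ForwardData.exists_gainMatrix_transpose_eq (h : ForwardData c I J P y B)
    (hne : I.Nonempty) (hφ : IsFundamentalSystem c I φ)
    (hψ : IsFundamentalSystem (backwardCoeff c J P y) I ψ) :
    ∃ C : Matrix (Fin (n + 1)) (Fin (n + 1)) ℝ, C.det ≠ 0 ∧
      ∀ t ∈ I, (gainMatrix n P J y φ t)ᵀ = wronskian ψ t * C := by
  obtain ⟨a, ha⟩ := hne
  have hb := h.continuousOn_backwardCoeff hφ
  have hd : ∀ t ∈ I, (wronskian ψ t).det ≠ 0 := fun t ht =>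
    hψ.det_wronskian_ne_zero h.isOpen h.ordConnected hb ht
  have hder : ∀ t ∈ I, HasEntryDerivAt
      (fun s => (wronskian ψ s)⁻¹ * (gainMatrix n P J y φ s)ᵀ) 0 t := by
    intro t ht
    refine ((hψ.hasEntryDerivAt_inv_wronskian h.isOpen h.ordConnected hb ht).mul
      (h.hasEntryDerivAt_gainMatrix_backward hφ ht)).congr_deriv ?_
    rw [Matrix.neg_mul, Matrix.mul_assoc, neg_add_cancel]
  refine ⟨(wronskian ψ a)⁻¹ * (gainMatrix n P J y φ a)ᵀ, ?_, fun t ht => ?_⟩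
  · rw [Matrix.det_mul, Matrix.det_transpose, gainMatrix, Matrix.det_mul]
    have hi : ∀ {M : Matrix (Fin (n + 1)) (Fin (n + 1)) ℝ}, M.det ≠ 0 → M⁻¹.det ≠ 0 :=
      fun hM => (Matrix.isUnit_nonsing_inv_det _ (isUnit_iff_ne_zero.2 hM)).ne_zero
    exact mul_ne_zero (hi (hd a ha)) (mul_ne_zero (hi (h.det_ne_zero hφ ha))
      (h.det_stateCov_ne_zero hφ ha))
  · rw [eq_of_hasEntryDerivAt_zero h.ordConnected hder ha ht, ← Matrix.mul_assoc,
      Matrix.mul_nonsing_inv _ (isUnit_iff_ne_zero.2 (hd t ht)), Matrix.one_mul]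

theorem kernel_eq_cov_state (s t : ℝ) :
    kernel P y s t = cov[state J y (0 : Fin (n + 1)) s, state J y (0 : Fin (n + 1)) t; P] := by
  have e : ∀ r, state J y (0 : Fin (n + 1)) r = y r := fun r => by
    ext ω; simp [state]
  rw [e, e, kernel]

/-- Below the diagonal the kernel is a nondegenerate bilinear expression in the forward and the
backward solutions. -/
theorem ForwardData.exists_kernel_eq (h : ForwardData c I J P y B)
    (hne : I.Nonempty) (hφ : IsFundamentalSystem c I φ)
    (hψ : IsFundamentalSystem (backwardCoeff c J P y) I ψ) :
    ∃ C : Matrix (Fin (n + 1)) (Fin (n + 1)) ℝ, C.det ≠ 0 ∧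
      ∀ s ∈ I, ∀ t ∈ I, s ≤ t →
        kernel P y s t = (fun k => ψ k s) ⬝ᵥ C *ᵥ fun k => φ k t := by
  obtain ⟨C, hC, hG⟩ := h.exists_gainMatrix_transpose_eq hne hφ hψ
  refine ⟨C, hC, fun s hs t ht hst => ?_⟩
  rw [kernel_eq_cov_state (n := n) (J := J), h.cov_state_state hφ hs ht hst]
  have h1 : wronskian φ t * gainMatrix n P J y φ s = wronskian φ t * (wronskian ψ s * C)ᵀ := by
    rw [← hG s hs, Matrix.transpose_transpose]
  rw [h1, Matrix.transpose_mul, ← Matrix.mul_assoc, Matrix.mul_apply, dotProduct]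
  refine Finset.sum_congr rfl fun k _ => ?_
  rw [Matrix.mul_apply, Matrix.mulVec, dotProduct, mul_comm]
  simp only [Matrix.transpose_apply, wronskian, Matrix.of_apply, Fin.val_zero, iteratedDeriv_zero]
  congr 1
  exact Finset.sum_congr rfl fun l _ => mul_comm _ _

/-- The two operators differ only in the last companion row. The shift rows are common, so a
relation between the functions passes to their derivatives of order at most n. -/
theorem wronskian_mulVec_add_eq_zero {c' : Fin (n + 1) → ℝ → ℝ} (hI : IsOpen I)
    (hφ : IsFundamentalSystem c I φ) (hψ : IsFundamentalSystem c' I ψ) {κ μ : Fin (n + 1) → ℝ}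
    (h : ∀ t ∈ I, ∑ k, κ k * φ k t + ∑ k, μ k * ψ k t = 0) {t : ℝ} (ht : t ∈ I) :
    wronskian φ t *ᵥ κ + wronskian ψ t *ᵥ μ = 0 := by
  have hz : ∀ i : Fin (n + 1), ∀ t ∈ I, (wronskian φ t *ᵥ κ) i + (wronskian ψ t *ᵥ μ) i = 0 := by
    intro i
    induction i using Fin.induction with
    | zero =>
      intro t ht
      have := h t ht
      simpa [Matrix.mulVec, dotProduct, wronskian, mul_comm] using this
    | succ i ih =>
      intro t ht
      have h1 := ((hφ.hasEntryDerivAt_wronskian hI ht).mulVec (v := fun _ => κ)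
        (v' := 0) (fun k => by simpa using hasDerivAt_const t (κ k)) i.castSucc).fun_add
        ((hψ.hasEntryDerivAt_wronskian hI ht).mulVec (v := fun _ => μ)
        (v' := 0) (fun k => by simpa using hasDerivAt_const t (μ k)) i.castSucc)
      have h2 : HasDerivAt (fun s => (wronskian φ s *ᵥ κ) i.castSucc +
          (wronskian ψ s *ᵥ μ) i.castSucc) 0 t :=
        (hasDerivAt_const t (0 : ℝ)).congr_of_eventuallyEq <| by
          filter_upwards [hI.mem_nhds ht] with s hs using ih s hs
      have h3 := h1.unique h2
      rwa [Matrix.mulVec_zero, Matrix.mulVec_zero, add_zero, add_zero, ← Matrix.mulVec_mulVec,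
        ← Matrix.mulVec_mulVec, companion_mulVec_castSucc, companion_mulVec_castSucc] at h3
  exact funext fun i => hz i t ht

/-- The forward and the backward solutions are jointly linearly independent. -/
theorem ForwardData.linearIndependent_sumElim (h : ForwardData c I J P y B)
    (hne : I.Nonempty) (hφ : IsFundamentalSystem c I φ)
    (hψ : IsFundamentalSystem (backwardCoeff c J P y) I ψ) :
    LinearIndependent ℝ fun (k : Fin (n + 1) ⊕ Fin (n + 1)) (t : I) => Sum.elim φ ψ k t := by
  rw [Fintype.linearIndependent_iff]
  intro a ha
  obtain ⟨C, hC, hG⟩ := h.exists_gainMatrix_transpose_eq hne hφ hψ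
  have hCu := isUnit_iff_ne_zero.2 hC
  set κ : Fin (n + 1) → ℝ := fun k => a (Sum.inl k)
  set μ : Fin (n + 1) → ℝ := fun k => a (Sum.inr k)
  have hsum : ∀ t ∈ I, ∑ k, κ k * φ k t + ∑ k, μ k * ψ k t = 0 := by
    intro t ht
    have := congrFun ha ⟨t, ht⟩
    simpa [κ, μ] using this
  have hW := fun t (ht : t ∈ I) => wronskian_mulVec_add_eq_zero h.isOpen hφ hψ hsum ht
  set v := C⁻¹ *ᵥ μ with hv
  have hμ : μ = C *ᵥ v := by
    rw [hv, Matrix.mulVec_mulVec, Matrix.mul_nonsing_inv _ hCu, Matrix.one_mulVec]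
  -- Multiplication of the Wronskian relation by Q gives κ + S(t)v = 0 with μ = Cv. The quadratic
  -- form of S at v is then constant in time, which forces v = 0.
  have hS : ∀ t ∈ I, κ + spreadMatrix n P J y φ t *ᵥ v = 0 := by
    intro t ht
    have h1 := congrArg ((wronskian φ t)⁻¹ *ᵥ ·) (hW t ht)
    simp only [Matrix.mulVec_add, Matrix.mulVec_mulVec, Matrix.mulVec_zero] at h1
    rw [Matrix.nonsing_inv_mul _ (isUnit_iff_ne_zero.2 (h.det_ne_zero hφ ht)), Matrix.one_mulVec,
      hμ, Matrix.mulVec_mulVec, Matrix.mul_assoc, ← hG t ht, inv_mul_gainMatrix_transpose] at h1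
    exact h1
  have hv0 : v = 0 := by
    refine h.eq_zero_of_dotProduct_spreadMatrix_const hφ h.isOpen subset_rfl hne (r := v ⬝ᵥ (-κ))
      fun t ht => ?_
    rw [eq_neg_of_add_eq_zero_right (hS t ht)]
  obtain ⟨t, ht⟩ := hne
  have hκ0 : κ = 0 := by simpa [hv0] using hS t ht
  have hμ0 : μ = 0 := by rw [hμ, hv0, Matrix.mulVec_zero]
  rintro (k | k)
  · exact congrFun hκ0 k
  · exact congrFun hμ0 k

end Factorization

/-! ### Time domains with finite or infinite end points. -/

section TimeIntervals

variable {t₀ T : EReal}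

theorem isOpen_openTimeInterval : IsOpen (openTimeInterval t₀ T) :=
  isOpen_Ioo.preimage continuous_coe_real_ereal

theorem ordConnected_openTimeInterval : (openTimeInterval t₀ T).OrdConnected :=
  ⟨fun _ ha _ hb _ hx => ⟨ha.1.trans_le (EReal.coe_le_coe_iff.2 hx.1),
    (EReal.coe_le_coe_iff.2 hx.2).trans_lt hb.2⟩⟩

theorem ordConnected_timeInterval : (timeInterval t₀ T).OrdConnected :=
  ⟨fun _ ha _ hb _ hx => ⟨ha.1.trans (EReal.coe_le_coe_iff.2 hx.1),
    (EReal.coe_le_coe_iff.2 hx.2).trans hb.2⟩⟩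

theorem openTimeInterval_subset : openTimeInterval t₀ T ⊆ timeInterval t₀ T :=
  fun _ h => ⟨h.1.le, h.2.le⟩

theorem nonempty_openTimeInterval (hT : t₀ < T) : (openTimeInterval t₀ T).Nonempty :=
  let ⟨x, hx⟩ := EReal.lt_iff_exists_real_btwn.1 hT
  ⟨x, hx⟩

theorem uniqueDiffOn_timeInterval (hT : t₀ < T) : UniqueDiffOn ℝ (timeInterval t₀ T) :=
  uniqueDiffOn_convex ordConnected_timeInterval.convex <|
    (nonempty_openTimeInterval hT).mono <|
      interior_maximal openTimeInterval_subset isOpen_openTimeInterval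

theorem timeInterval_subset_closure (hT : t₀ < T) :
    timeInterval t₀ T ⊆ closure (openTimeInterval t₀ T) := by
  intro t ht
  obtain ⟨a, ha⟩ := nonempty_openTimeInterval hT
  rcases lt_trichotomy a t with h | rfl | h
  · refine closure_mono (s := Ioo a t) (fun u hu => ?_) ?_
    · exact ⟨ha.1.trans (EReal.coe_lt_coe_iff.2 hu.1),
        (EReal.coe_lt_coe_iff.2 hu.2).trans_le ht.2⟩
    · rw [closure_Ioo h.ne]; exact right_mem_Icc.2 h.le
  · exact subset_closure ha
  · refine closure_mono (s := Ioo t a) (fun u hu => ?_) ?_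
    · exact ⟨ht.1.trans_lt (EReal.coe_lt_coe_iff.2 hu.1),
        (EReal.coe_lt_coe_iff.2 hu.2).trans ha.2⟩
    · rw [closure_Ioo h.ne]; exact left_mem_Icc.2 h.le

theorem forwardData_openTimeInterval {Ω : Type*} [MeasurableSpace Ω] {P : Measure Ω} {n : ℕ}
    {c : Fin (n + 1) → ℝ → ℝ} {y B : ℝ → Ω → ℝ} (hT : t₀ < T)
    (hc : ∀ i, ContinuousOn (c i) (timeInterval t₀ T))
    (hy : IsForwardSolution c (timeInterval t₀ T) P y B) :
    ForwardData c (openTimeInterval t₀ T) (timeInterval t₀ T) P y B :=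
  ⟨isOpen_openTimeInterval, ordConnected_openTimeInterval, ordConnected_timeInterval,
    uniqueDiffOn_timeInterval hT, openTimeInterval_subset, hc, hy⟩

end TimeIntervals

/-! ### Kernel packets in one coordinate. -/

section KernelPackets

variable {Ω : Type*} [MeasurableSpace Ω] {P : Measure Ω} [IsProbabilityMeasure P]
  {n N : ℕ} {c : Fin (n + 1) → ℝ → ℝ} {I J : Set ℝ} {y B : ℝ → Ω → ℝ}
  {φ ψ : Fin (n + 1) → ℝ → ℝ}

theorem isOpen_outside (τ : Fin N → ℝ) : IsOpen (outside τ) := by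
  have h1 : IsOpen {r | ∀ i, r < τ i} := by
    simp only [Set.ofPred_forall]
    exact isOpen_iInter_of_finite fun i => isOpen_Iio
  have h2 : IsOpen {r | ∀ i, τ i < r} := by
    simp only [Set.ofPred_forall]
    exact isOpen_iInter_of_finite fun i => isOpen_Ioi
  exact h1.union h2

theorem kernel_comm (s t : ℝ) : kernel P y s t = kernel P y t s := covariance_comm _ _

theorem ForwardData.continuousOn_kernel (h : ForwardData c I J P y B) {t : ℝ} (ht : t ∈ J) :
    ContinuousOn (fun s => kernel P y s t) J := by
  refine (h.continuousOn_covState (h.solution.memLp_state ht 0) 0).congr fun s _ => ?_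
  rw [kernel_comm, kernel_eq_cov_state (n := n) (J := J)]
  rfl

theorem sum_mul_dotProduct_mulVec {κ : Type*} [Fintype κ] (C : Matrix κ κ ℝ) (a : Fin N → ℝ)
    (v : κ → ℝ) (w : κ → ℝ → ℝ) (τ : Fin N → ℝ) :
    ∑ i, a i * (v ⬝ᵥ C *ᵥ fun k => w k (τ i)) = v ⬝ᵥ C *ᵥ fun k => ∑ i, a i * w k (τ i) := by
  have e : (fun k => ∑ i, a i * w k (τ i)) = ∑ i, a i • fun k => w k (τ i) := by
    ext k; simp
  simp only [e, Matrix.mulVec_sum, dotProduct_sum, Matrix.mulVec_smul, dotProduct_smul, smul_eq_mul]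

theorem sum_mul_dotProduct_mulVec' {κ : Type*} [Fintype κ] (C : Matrix κ κ ℝ) (a : Fin N → ℝ)
    (v : κ → ℝ) (w : κ → ℝ → ℝ) (τ : Fin N → ℝ) :
    ∑ i, a i * ((fun k => w k (τ i)) ⬝ᵥ C *ᵥ v) = (fun k => ∑ i, a i * w k (τ i)) ⬝ᵥ C *ᵥ v := by
  have e : (fun k => ∑ i, a i * w k (τ i)) = ∑ i, a i • fun k => w k (τ i) := by
    ext k; simp
  simp only [e, sum_dotProduct, smul_dotProduct, smul_eq_mul]

/-- A combination of sections of the kernel vanishes outside the range of its nodes exactly if the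
coefficients annihilate all forward and backward solutions. -/
theorem ForwardData.sum_solutions_eq_zero_iff (h : ForwardData c I J P y B)
    (hJI : J ⊆ closure I) (hφ : IsFundamentalSystem c I φ)
    (hψ : IsFundamentalSystem (backwardCoeff c J P y) I ψ) {τ : Fin (N + 1) → ℝ}
    (hτ : ∀ i, τ i ∈ I) (a : Fin (N + 1) → ℝ) :
    (∀ k, ∑ i, a i * Sum.elim φ ψ k (τ i) = 0) ↔
      ∀ s ∈ outside τ, s ∈ J → ∑ i, a i * kernel P y s (τ i) = 0 := by
  obtain ⟨C, hC, hK⟩ := h.exists_kernel_eq ⟨τ 0, hτ 0⟩ hφ hψ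
  have hlt : ∀ s ∈ I, (∀ i, s < τ i) → ∑ i, a i * kernel P y s (τ i) =
      (fun k => ψ k s) ⬝ᵥ C *ᵥ fun k => ∑ i, a i * φ k (τ i) := by
    intro s hs hlt
    rw [← sum_mul_dotProduct_mulVec]
    exact Finset.sum_congr rfl fun i _ => by rw [hK s hs _ (hτ i) (hlt i).le]
  have hgt : ∀ s ∈ I, (∀ i, τ i < s) → ∑ i, a i * kernel P y s (τ i) =
      (fun k => ∑ i, a i * ψ k (τ i)) ⬝ᵥ C *ᵥ fun k => φ k s := by
    intro s hs hgt
    rw [← sum_mul_dotProduct_mulVec']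
    exact Finset.sum_congr rfl fun i _ => by rw [kernel_comm, hK _ (hτ i) s hs (hgt i).le]
  constructor
  · intro hz
    have hI : EqOn (fun s => ∑ i, a i * kernel P y s (τ i)) (fun _ => 0) (outside τ ∩ I) := by
      rintro s ⟨hs | hs, hsI⟩
      · have e : (fun k => ∑ i, a i * φ k (τ i)) = 0 := funext fun k => hz (Sum.inl k)
        simp only [hlt s hsI hs, e, Matrix.mulVec_zero, dotProduct_zero]
      · have e : (fun k => ∑ i, a i * ψ k (τ i)) = 0 := funext fun k => hz (Sum.inr k)
        simp only [hgt s hsI hs, e, zero_dotProduct]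
    -- The factorization is known on `I` only; end points in `J` are reached by continuity, `outside
    -- τ` being open.
    have hcont : ContinuousOn (fun s => ∑ i, a i * kernel P y s (τ i)) (outside τ ∩ J) :=
      continuousOn_finsetSum _ fun i _ => continuousOn_const.mul
        ((h.continuousOn_kernel (h.subset (hτ i))).mono inter_subset_right)
    have hext := hI.of_subset_closure hcont continuousOn_const
      (inter_subset_inter_right _ h.subset)
      ((inter_subset_inter_right _ hJI).trans (isOpen_outside τ).inter_closure)
    exact fun s hs hsJ => hext ⟨hs, hsJ⟩
  · intro hz
    obtain ⟨imin, himin⟩ := Finite.exists_min τ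
    obtain ⟨imax, himax⟩ := Finite.exists_max τ
    -- Openness of `I` leaves a nonempty interval on each side of the nodes: the left one detects
    -- the φ sums, the right one the ψ sums.
    obtain ⟨l, hl, b, hb, ⟨hl', -⟩, ⟨-, hb'⟩⟩ := exists_Ioo_mem_of_isOpen h.isOpen
      (hτ imin) (hτ imax)
    have hA : C *ᵥ (fun k => ∑ i, a i * φ k (τ i)) = 0 := by
      refine hψ.eq_zero_of_eqOn_open h.isOpen h.ordConnected (h.continuousOn_backwardCoeff hφ)
        isOpen_Ioo (O := Ioo l (τ imin))
        (Ioo_subset_Icc_self.trans (h.ordConnected.out hl (hτ imin))) (nonempty_Ioo.2 hl')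
        fun s hs => ?_
      have hsI : s ∈ I := h.ordConnected.out hl (hτ imin) (Ioo_subset_Icc_self hs)
      have hs' : ∀ i, s < τ i := fun i => hs.2.trans_le (himin i)
      rw [← hz s (Or.inl hs') (h.subset hsI), hlt s hsI hs', dotProduct]
      exact Finset.sum_congr rfl fun k _ => mul_comm _ _
    have hA' : (fun k => ∑ i, a i * ψ k (τ i)) ᵥ* C = 0 := by
      refine hφ.eq_zero_of_eqOn_open h.isOpen h.ordConnected h.continuousOn_coeff
        isOpen_Ioo (O := Ioo (τ imax) b)
        (Ioo_subset_Icc_self.trans (h.ordConnected.out (hτ imax) hb)) (nonempty_Ioo.2 hb')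
        fun s hs => ?_
      have hsI : s ∈ I := h.ordConnected.out (hτ imax) hb (Ioo_subset_Icc_self hs)
      have hs' : ∀ i, τ i < s := fun i => (himax i).trans_lt hs.1
      rw [← hz s (Or.inr hs') (h.subset hsI), hgt s hsI hs', Matrix.dotProduct_mulVec, dotProduct]
    rintro (k | k)
    · by_contra hk
      exact hC (Matrix.exists_mulVec_eq_zero_iff.1 ⟨_, fun e => hk (congrFun e k), hA⟩)
    · by_contra hk
      exact hC (Matrix.exists_vecMul_eq_zero_iff.1 ⟨_, fun e => hk (congrFun e k), hA'⟩)

end KernelPackets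

/-! ### Linear algebra of minimal systems. -/

section Minimality

theorem exists_sum_smul_eq_zero {ι : Type*} [Fintype ι] {N : ℕ} (hN : Fintype.card ι < N)
    (v : Fin N → ι → ℝ) : ∃ a : Fin N → ℝ, a ≠ 0 ∧ ∑ i, a i • v i = 0 := by
  have h : ¬ LinearIndependent ℝ v := fun h => by
    have := h.fintype_card_le_finrank
    simp at this
    omega
  obtain ⟨a, ha, i, hi⟩ := Fintype.not_linearIndependent_iff.1 h
  exact ⟨a, fun e => hi (congrFun e i), ha⟩

/-- If the values of `H` did not span, a nonzero functional vanishing on all of them would be a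
relation between the components. So they span, and a basis can be picked among them. -/
theorem exists_linearIndependent_points {X ι : Type*} [Fintype ι] {H : X → ι → ℝ}
    (hH : LinearIndependent ℝ fun (k : ι) (x : X) => H x k) :
    ∃ x : Fin (Fintype.card ι) → X, LinearIndependent ℝ fun i => H (x i) := by
  classical
  have htop : Submodule.span ℝ (range H) = ⊤ := by
    by_contra hne
    obtain ⟨f, hf, hle⟩ := Submodule.exists_le_ker_of_lt_top _ (lt_top_iff_ne_top.2 hne)
    have hz := Fintype.linearIndependent_iff.1 hH (fun k => f (Pi.single k 1)) <| by
      ext x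
      have hx : f (H x) = 0 := hle (Submodule.subset_span ⟨x, rfl⟩)
      rw [← Finset.univ_sum_single (H x), map_sum] at hx
      simp only [Finset.sum_apply, Pi.smul_apply, smul_eq_mul, Pi.zero_apply]
      rw [← hx]
      refine Finset.sum_congr rfl fun k _ => ?_
      have e : (Pi.single k (H x k) : ι → ℝ) = H x k • Pi.single k 1 := by
        rw [← Pi.single_smul]; simp
      rw [e, map_smul, smul_eq_mul, mul_comm]
    refine hf (LinearMap.pi_ext' fun k => LinearMap.ext_ring ?_)
    simpa using hz k
  obtain ⟨f, hf, -, hli⟩ := Submodule.exists_fun_fin_finrank_span_eq ℝ (range H)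
  have hr : Module.finrank ℝ (Submodule.span ℝ (range H)) = Fintype.card ι := by
    rw [htop, finrank_top, Module.finrank_fintype_fun_eq_card]
  choose x hx using hf
  refine ⟨fun i => x (Fin.cast hr.symm i), ?_⟩
  simp only [hx]
  exact hli.comp _ (Fin.cast_injective _)

theorem isMinimalSystem_iff_linearIndependent {X ι : Type*} [Fintype ι] (H : X → ι → ℝ) :
    IsMinimalSystem H ↔ LinearIndependent ℝ fun (k : ι) (x : X) => H x k := by
  refine ⟨fun h => h.1, fun h => ⟨h, fun x => exists_sum_smul_eq_zero (Nat.lt_succ_self _) _,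
    fun N hN => ?_⟩⟩
  by_contra hlt
  have hle : N ≤ Fintype.card ι := by omega
  obtain ⟨x, hx⟩ := exists_linearIndependent_points h
  obtain ⟨a, ha, hsum⟩ := hN fun i => x (Fin.castLE hle i)
  exact ha <| funext <| Fintype.linearIndependent_iff.1
    (hx.comp _ (Fin.castLE_injective hle)) a hsum

/-- Functions of separate coordinates, linearly independent in each coordinate, are jointly
linearly independent exactly if the constants are spanned in at most one coordinate. -/
theorem linearIndependent_separate_iff {D : ℕ} {κ : Type*} [Fintype κ] {I : Fin D → Set ℝ}
    (hI : ∀ d, (I d).Nonempty) (u : Fin D → κ → ℝ → ℝ)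
    (hu : ∀ d, LinearIndependent ℝ fun (k : κ) (t : I d) => u d k t) :
    (LinearIndependent ℝ fun (k : Fin D × κ) (x : {x : Fin D → ℝ // ∀ d, x d ∈ I d}) =>
        u k.1 k.2 (x.1 k.1)) ↔
      ∀ d d' : Fin D,
        (fun _ : I d => (1 : ℝ)) ∈ Submodule.span ℝ (range fun (k : κ) (t : I d) => u d k t) →
        (fun _ : I d' => (1 : ℝ)) ∈
          Submodule.span ℝ (range fun (k : κ) (t : I d') => u d' k t) → d = d' := by
  classical
  simp only [Submodule.mem_span_range_iff_exists_fun]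
  constructor
  · rintro hli d d' ⟨a, ha⟩ ⟨a', ha'⟩
    by_contra hdd
    have hz := Fintype.linearIndependent_iff.1 hli
      -- Two representations of the constant 1, in different coordinates, subtract to a nontrivial
      -- relation.
      (fun k => (if k.1 = d then a k.2 else 0) - if k.1 = d' then a' k.2 else 0) <| by
        ext x
        have h1 := congrFun ha ⟨x.1 d, x.2 d⟩
        have h2 := congrFun ha' ⟨x.1 d', x.2 d'⟩
        simp only [Finset.sum_apply, Pi.smul_apply, smul_eq_mul] at h1 h2
        simp only [Finset.sum_apply, Pi.smul_apply, smul_eq_mul, Pi.zero_apply, sub_mul, ite_mul,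
          zero_mul, Finset.sum_sub_distrib, Fintype.sum_prod_type]
        rw [Finset.sum_comm, Finset.sum_comm (f := fun e k => if e = d' then _ else _)]
        simp [h1, h2]
    have ha0 : ∀ k, a k = 0 := fun k => by simpa [hdd] using hz (d, k)
    obtain ⟨t, ht⟩ := hI d
    have := congrFun ha ⟨t, ht⟩
    simp [ha0] at this
  · intro hone
    rw [Fintype.linearIndependent_iff]
    intro a ha
    set f : Fin D → ℝ → ℝ := fun d t => ∑ k, a (d, k) * u d k t with hf
    have hsum : ∀ x : Fin D → ℝ, (∀ d, x d ∈ I d) → ∑ d, f d (x d) = 0 := by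
      intro x hx
      have := congrFun ha ⟨x, hx⟩
      simpa [Fintype.sum_prod_type, hf] using this
    choose x₀ hx₀ using hI
    -- Moving a single coordinate while the sum stays zero shows that each summand is constant.
    have hconst : ∀ d, ∀ t ∈ I d, f d t = f d (x₀ d) := by
      intro d t ht
      have h1 := hsum (Function.update x₀ d t) fun e => by
        by_cases he : e = d
        · subst he; simpa using ht
        · simpa [Function.update_of_ne he] using hx₀ e
      have h2 := hsum x₀ hx₀
      rw [← Finset.add_sum_erase _ _ (Finset.mem_univ d)] at h1 h2
      rw [Finset.sum_congr rfl fun e he => by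
        rw [Function.update_of_ne (Finset.ne_of_mem_erase he)]] at h1
      rw [Function.update_self] at h1
      linarith
    have hmem : ∀ d, f d (x₀ d) ≠ 0 →
        ∃ b : κ → ℝ, ∑ k, b k • (fun t : I d => u d k t) = fun _ : I d => (1 : ℝ) := by
      intro d hd
      refine ⟨fun k => (f d (x₀ d))⁻¹ * a (d, k), ?_⟩
      ext t
      have := hconst d t t.2
      simp only [Finset.sum_apply, Pi.smul_apply, smul_eq_mul, mul_assoc, ← Finset.mul_sum]
      change (f d (x₀ d))⁻¹ * f d t = 1
      rw [this, inv_mul_cancel₀ hd]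
    -- A nonzero constant summand puts the constants in its span. At most one coordinate allows
    -- this, and a single nonzero summand contradicts the zero sum.
    have hzero : ∀ d, f d (x₀ d) = 0 := by
      intro d
      by_contra hd
      have h2 := hsum x₀ hx₀
      rw [Finset.sum_eq_single d (fun e _ he => by
        by_contra hne
        exact he (hone e d (hmem e hne) (hmem d hd))) (by simp)] at h2
      exact hd h2
    rintro ⟨d, k⟩
    refine Fintype.linearIndependent_iff.1 (hu d) (fun k => a (d, k)) ?_ k
    ext t
    have := hconst d t t.2
    rw [hzero d] at this
    simpa [hf] using this

end Minimality

theorem sum_smul_stackedSolutions_eq_zero_iff {D m N : ℕ} {φ ψ : Fin D → Fin m → ℝ → ℝ}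
    (a : Fin N → ℝ) (x : Fin N → Fin D → ℝ) :
    ∑ i, a i • stackedSolutions φ ψ (x i) = 0 ↔
      ∀ d, ∀ k, ∑ i, a i * Sum.elim (φ d) (ψ d) k (x i d) = 0 := by
  simp [funext_iff, stackedSolutions, Prod.forall]

end KernelPacket

end

/-! ### Assembly over the coordinates. -/

open KernelPacket in
theorem mainTheorem9 {D m : ℕ} (hm : 1 ≤ m)
    (t₀ T : Fin D → EReal) (hT : ∀ d, t₀ d < T d)
    (c : Fin D → Fin m → ℝ → ℝ)
    (hc : ∀ d i, ContinuousOn (c d i) (timeInterval (t₀ d) (T d)))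
    {Ω : Fin D → Type*} [∀ d, MeasurableSpace (Ω d)]
    (P : ∀ d, Measure (Ω d)) [∀ d, IsProbabilityMeasure (P d)]
    (y B : ∀ d, ℝ → Ω d → ℝ)
    (hy : ∀ d, IsForwardSolution (c d) (timeInterval (t₀ d) (T d)) (P d) (y d) (B d))
    (φ ψ : Fin D → Fin m → ℝ → ℝ)
    (hφ : ∀ d, IsFundamentalSystem (c d) (openTimeInterval (t₀ d) (T d)) (φ d))
    (hψ : ∀ d, IsFundamentalSystem
      (backwardCoeff (c d) (timeInterval (t₀ d) (T d)) (P d) (y d))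
      (openTimeInterval (t₀ d) (T d)) (ψ d)) :
    (∀ x : Fin (2 * m * D + 1) → Fin D → ℝ,
      (∀ i d, x i d ∈ openTimeInterval (t₀ d) (T d)) →
      (∃ a : Fin (2 * m * D + 1) → ℝ, a ≠ 0 ∧
        ∑ i, a i • stackedSolutions φ ψ (x i) = 0) ∧
      ∀ a : Fin (2 * m * D + 1) → ℝ,
        (∑ i, a i • stackedSolutions φ ψ (x i) = 0 →
          ∀ r ∈ outsideBox x, (∀ d, r d ∈ timeInterval (t₀ d) (T d)) →
            ∑ i, a i * additiveKernel (fun d => kernel (P d) (y d)) r (x i) = 0) ∧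
        (∑ i, a i • stackedSolutions φ ψ (x i) = 0 ↔
          ∀ d, ∀ s ∈ outside (fun i => x i d), s ∈ timeInterval (t₀ d) (T d) →
            ∑ i, a i * kernel (P d) (y d) s (x i d) = 0)) ∧
    (IsMinimalSystem (fun x : {x : Fin D → ℝ // ∀ d, x d ∈ openTimeInterval (t₀ d) (T d)} =>
        stackedSolutions φ ψ x.1) ↔
      ∀ d d' : Fin D,
        ContainsConstants (openTimeInterval (t₀ d) (T d)) (φ d) (ψ d) →
        ContainsConstants (openTimeInterval (t₀ d') (T d')) (φ d') (ψ d') → d = d') := by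
  obtain ⟨n, rfl⟩ : ∃ n, m = n + 1 := ⟨m - 1, (Nat.sub_add_cancel hm).symm⟩
  have hF := fun d => forwardData_openTimeInterval (hT d) (hc d) (hy d)
  have hne := fun d => nonempty_openTimeInterval (hT d)
  refine ⟨fun x hx => ⟨exists_sum_smul_eq_zero ?_ _, fun a => ?_⟩, ?_⟩
  · simp only [Fintype.card_prod, Fintype.card_sum, Fintype.card_fin]
    linarith
  · have hiff : ∑ i, a i • stackedSolutions φ ψ (x i) = 0 ↔
          ∀ d, ∀ s ∈ outside (fun i => x i d), s ∈ timeInterval (t₀ d) (T d) →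
            ∑ i, a i * kernel (P d) (y d) s (x i d) = 0 := by
      rw [sum_smul_stackedSolutions_eq_zero_iff]
      exact forall_congr' fun d => (hF d).sum_solutions_eq_zero_iff
        (timeInterval_subset_closure (hT d)) (hφ d) (hψ d) (fun i => hx i d) a
    -- For the additive kernel the sum splits by coordinates, and each part vanishes separately
    -- because the box is a product.
    refine ⟨fun h r hr hrJ => ?_, hiff⟩
    simp only [additiveKernel, Finset.mul_sum]
    rw [Finset.sum_comm]
    exact Finset.sum_eq_zero fun d _ => hiff.1 h d (r d) (hr d) (hrJ d)
  · rw [isMinimalSystem_iff_linearIndependent]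
    exact linearIndependent_separate_iff hne (fun d => Sum.elim (φ d) (ψ d))
      fun d => (hF d).linearIndependent_sumElim (hne d) (hφ d) (hψ d)
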